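/- Let $X$ be a smooth manifold with a smooth transitive action of a compact connected Lie group $G$, equipped with a finite nonzero $G$-invariant Borel measure $\mu_X$, and write $|X|=\mu_X(X)$. Let $\mathcal H\neq 0$ be a finite-dimensional (continuous) unitary representation of $G$, fix $x_0\in X$, and let $K\subseteq G$ be the stabilizer of $x_0$. For operators $\rho,\sigma$ on $\mathcal H$ and $\alpha\in[0,1]$ put $$\beta_\alpha(\rho,\sigma)=\inf\{\operatorname{tr}(\sigma E): 0\le E\le \mathbb 1,\ \operatorname{tr}(\rho E)\ge\alpha\}.$$ A *covariant family* is a $\mu_X$-measurable family $(\rho^x)_{x\in X}$ of states (density operators) on $\mathcal H$ with $\rho^{gx}=g\rho^xg^{-1}$ for all $g\in G$, $x\in X$. A *region estimator* consists of a POVM $M$ on $\mathcal H$ with outcomes in a measurable space $Y$ and a measurable set $\mathcal E\subseteq X\times Y$. For the uniform prior $\mathbb 1_X/|X|$ its success probability and maximal volume are $$p_{\rm succ}=\frac1{|X|}\int_X \operatorname{tr}\bigl(\rho^xM(\{y:(x,y)\in\mathcal E\})\bigr)\,d\mu_X(x),\qquad V_{\max}=\sup_{y\in Y}\mu_X(\{x:(x,y)\in\mathcal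 E\}).$$ Let $\lambda$ range over the isomorphism classes of irreducible $G$-representations $V_{G,\lambda}$ occurring in $\mathcal H$, and $\mu$ over the isomorphism classes of irreducible $K$-representations $V_{K,\mu}$ occurring in $\mathcal H|_K$. Let $d_\lambda,d_\mu$ be their dimensions, $m_\lambda$ the multiplicity of $V_{G,\lambda}$ in $\mathcal H$, $m^\lambda_\mu$ the multiplicity of $V_{K,\mu}$ in $V_{G,\lambda}|_K$, and $r^\lambda_\mu=\min\{m^\lambda_\mu,m_\lambda\}$. Then for every $\alpha\in[0,1]$ $$\inf_{\rho}\ \sup_{\tilde\sigma}\ \beta_{\alpha}(\rho,\tilde\sigma)=\frac{\alpha}{\max_\mu\sum_\lambda d_\lambda r^\lambda_\mu/d_\mu},$$ where the infimum runs over all $K$-invariant states $\rho$ and the supremum over all $G$-invariant states $\tilde\sigma$ on $\mathcal H$. For every covariant family and every region estimator, with the uniform prior, $p_{\rm succ}\le 1$ and $$\frac{V_{\max}}{|X|}\ \ge\ \inf_{\rho}\ \sup_{\tilde\sigma}\ \beta_{p_{\rm succ}}(\rho,\tilde\sigma)=\frac{p_{\rm succ}}{\max_\mu\sum_\lambda d_\lambda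 r^\lambda_\mu/d_\mu}.$$ In particular, if $X=G$ (more generally, if $K$ is trivial), then the infimum equals $\alpha/\sum_\lambda d_\lambda r_\lambda$ for every $\alpha\in[0,1]$, where $r_\lambda=\min\{d_\lambda,m_\lambda\}$, and $$\frac{V_{\max}}{|X|}\ \ge\ \frac{p_{\rm succ}}{\sum_\lambda d_\lambda r_\lambda}.$$ -/

import Mathlib

open MeasureTheory
open scoped ENNReal Manifold ContDiff

namespace RegionEstimation

noncomputable section

section Quantum

variable {H : Type*} [NormedAddCommGroup H] [InnerProductSpace ℂ H]

/-- `A` is a quantum state (density operator) on the finite-dimensional Hilbert space `H`: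
it is positive semidefinite (Loewner order) and has trace one. -/
structure IsState (A : H →L[ℂ] H) : Prop where
  nonneg : 0 ≤ A
  trace_eq_one : LinearMap.trace ℂ H (A : H →ₗ[ℂ] H) = 1

/-- The expectation value `⟨A, E⟩ = tr (A E)`.  It is a real number whenever `A` and `E` are
Hermitian, so that taking the real part loses nothing. -/
def expVal (A E : H →L[ℂ] H) : ℝ :=
  (LinearMap.trace ℂ H ((A * E : H →L[ℂ] H) : H →ₗ[ℂ] H)).re

/-- The hypothesis-testing quantity
`β_α(ρ, σ) = inf {⟨σ, E⟩ : 0 ≤ E ≤ 1, ⟨ρ, E⟩ ≥ α}`. Expectation values of positive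
semidefinite operators in states are nonnegative, and are regarded as elements of `[0, ∞]`. -/
def beta (α : ℝ≥0∞) (ρ σ : H →L[ℂ] H) : ℝ≥0∞ :=
  ⨅ (E : H →L[ℂ] H) (_ : 0 ≤ E) (_ : E ≤ 1) (_ : α ≤ ENNReal.ofReal (expVal ρ E)),
    ENNReal.ofReal (expVal σ E)

/-- A POVM on `H` with outcomes in the measurable space `Y`: a `σ`-additive operator-valued
function on the measurable sets, with positive semidefinite values and total mass the identity.
(A `VectorMeasure` is `σ`-additive, vanishes at `∅`, and has the junk value `0` on nonmeasurable
sets.) -/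
structure POVM (Y : Type*) [MeasurableSpace Y] (H : Type*) [NormedAddCommGroup H]
    [InnerProductSpace ℂ H] extends VectorMeasure Y (H →L[ℂ] H) where
  nonneg : ∀ O : Set Y, MeasurableSet O → 0 ≤ measureOf' O
  univ_eq_one : measureOf' Set.univ = 1

end Quantum

section Estimator

/-- A region estimator for the parameter space `X`: a POVM with outcomes in `Y`, together with a
measurable look-up table `table ⊆ X × Y`. -/
structure RegionEstimator (X Y H : Type*) [MeasurableSpace X] [MeasurableSpace Y]
    [NormedAddCommGroup H] [InnerProductSpace ℂ H] where
  povm : POVM Y H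
  table : Set (X × Y)
  measurableSet_table : MeasurableSet table

variable {X Y H : Type*} [MeasurableSpace X] [MeasurableSpace Y]
  [NormedAddCommGroup H] [InnerProductSpace ℂ H]

/-- The region `{x | (x, y) ∈ table}` reported for the measurement outcome `y`. -/
def RegionEstimator.region (est : RegionEstimator X Y H) (y : Y) : Set X :=
  {x | (x, y) ∈ est.table}

/-- The set `{y | (x, y) ∈ table}` of outcomes for which the estimator succeeds if the true
parameter is `x`. -/
def RegionEstimator.compatible (est : RegionEstimator X Y H) (x : X) : Set Y :=
  {y | (x, y) ∈ est.table}

/-- The maximal volume `V_max = sup_y μ(region y)`. -/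
def RegionEstimator.maxVolume (est : RegionEstimator X Y H) (vol : Measure X) : ℝ≥0∞ :=
  ⨆ y : Y, vol (est.region y)

/-- The average success probability `∫ p(x) ⟨ρ^x, M(compatible x)⟩ dμ(x)` for the prior with
density `p` with respect to `μ` and the family of probe states `ρ`. -/
def RegionEstimator.successProb (est : RegionEstimator X Y H) (vol : Measure X) (p : X → ℝ≥0∞)
    (ρ : X → H →L[ℂ] H) : ℝ≥0∞ :=
  ∫⁻ x, p x * ENNReal.ofReal (expVal (ρ x) (est.povm.measureOf' (est.compatible x))) ∂vol

/-- The density of the uniform prior. -/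
def uniformPrior (vol : Measure X) : X → ℝ≥0∞ := fun _ => (vol Set.univ)⁻¹

end Estimator

section Representations

variable {G : Type*} [Group G]

/-- The irreducible subrepresentations of a representation. -/
abbrev IrredSub {V : Type*} [AddCommGroup V] [Module ℂ V] (π : Representation ℂ G V) : Type _ :=
  {W : Subrepresentation π // W.toRepresentation.IsIrreducible}

/-- Isomorphism of irreducible subrepresentations. -/
instance irredSetoid {V : Type*} [AddCommGroup V] [Module ℂ V] (π : Representation ℂ G V) :
    Setoid (IrredSub π) where
  r W W' := Nonempty (W.1.toRepresentation.Equiv W'.1.toRepresentation)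
  iseqv :=
    { refl := fun W => ⟨.refl W.1.toRepresentation⟩
      symm := fun ⟨f⟩ => ⟨f.symm⟩
      trans := fun ⟨f⟩ ⟨g⟩ => ⟨f.trans g⟩ }

/-- The isomorphism classes of irreducible representations that occur in `π`, that is, the
labels of the summands in the isotypical decomposition of `π`. -/
abbrev Isotype {V : Type*} [AddCommGroup V] [Module ℂ V] (π : Representation ℂ G V) : Type _ :=
  Quotient (irredSetoid π)

/-- The space of a representative of an isotype. -/
abbrev Isotype.space {V : Type*} [AddCommGroup V] [Module ℂ V] {π : Representation ℂ G V}
    (l : Isotype π) : Submodule ℂ V :=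
  (Quotient.out l).1.toSubmodule

/-- The irreducible representation that represents an isotype. -/
abbrev Isotype.rep {V : Type*} [AddCommGroup V] [Module ℂ V] {π : Representation ℂ G V}
    (l : Isotype π) : Representation ℂ G l.space :=
  (Quotient.out l).1.toRepresentation

/-- The dimension of an isotype. -/
def Isotype.dim {V : Type*} [AddCommGroup V] [Module ℂ V] {π : Representation ℂ G V}
    (l : Isotype π) : ℕ :=
  Module.finrank ℂ l.space

/-- The multiplicity of an irreducible representation `σ` in `τ`, as the dimension
of the space of intertwiners from `σ` to `τ`. -/
def multiplicity {V W : Type*} [AddCommGroup V] [Module ℂ V] [AddCommGroup W] [Module ℂ W]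
    (σ : Representation ℂ G V) (τ : Representation ℂ G W) : ℕ :=
  Module.finrank ℂ (Representation.IntertwiningMap σ τ)

/-- The restriction of a representation to a subgroup. -/
abbrev restrictRep {V : Type*} [AddCommGroup V] [Module ℂ V] (π : Representation ℂ G V)
    (K : Subgroup G) : Representation ℂ K V :=
  π.comp K.subtype

variable {H : Type*} [NormedAddCommGroup H] [InnerProductSpace ℂ H]

/-- The sum `∑_λ d_λ r^λ_μ / d_μ` for an irreducible representation `μ` of `K` occurring in
the restriction of `π` to `K`, where `λ` runs over the isotypes of `π`, and
`r^λ_μ = min (m^λ_μ, m_λ)` with `m_λ` the multiplicity of `V_λ` in `π` and `m^λ_μ` the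
multiplicity of `V_μ` in the restriction of `V_λ` to `K`. -/
def branchingSum {V : Type*} [AddCommGroup V] [Module ℂ V] (π : Representation ℂ G V)
    (K : Subgroup G) (m : Isotype (restrictRep π K)) : ℝ≥0∞ :=
  ∑' l : Isotype π,
    (l.dim : ℝ≥0∞) *
      (min (multiplicity m.rep (restrictRep l.rep K)) (multiplicity l.rep π) : ℕ) / (m.dim : ℝ≥0∞)

/-- The sum `∑_λ d_λ r_λ`, with `r_λ = min (d_λ, m_λ)`. -/
def groupSum {V : Type*} [AddCommGroup V] [Module ℂ V] (π : Representation ℂ G V) : ℝ≥0∞ :=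
  ∑' l : Isotype π, (l.dim : ℝ≥0∞) * (min l.dim (multiplicity l.rep π) : ℕ)

variable [CompleteSpace H]

/-- The representation on the underlying vector space of a group of unitary operators. -/
def toRep (U : G →* unitary (H →L[ℂ] H)) : Representation ℂ G H where
  toFun g := ((U g : H →L[ℂ] H) : H →ₗ[ℂ] H)
  map_one' := by ext v; simp
  map_mul' g h := by ext v; simp

/-- The conjugation `g A g⁻¹`. -/
def conjOp (U : G →* unitary (H →L[ℂ] H)) (g : G) (A : H →L[ℂ] H) : H →L[ℂ] H :=
  (U g : H →L[ℂ] H) * A * (U g⁻¹ : H →L[ℂ] H)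

/-- The set of states that are invariant under the subgroup `K`. -/
def invariantStates (U : G →* unitary (H →L[ℂ] H)) (K : Subgroup G) : Set (H →L[ℂ] H) :=
  {A | IsState A ∧ ∀ g ∈ K, conjOp U g A = A}

/-- The universal quantity `inf_ρ sup_σ β_α(ρ, σ)`, where `ρ` runs over the `K`-invariant states
and `σ` over the `G`-invariant states. -/
def infSupBeta (U : G →* unitary (H →L[ℂ] H)) (K : Subgroup G) (α : ℝ≥0∞) : ℝ≥0∞ :=
  ⨅ ρ ∈ invariantStates U K, ⨆ σ ∈ invariantStates U (⊤ : Subgroup G), beta α ρ σ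

/-- A covariant family of probe states: a measurable family of states with
`ρ^{g x} = g ρ^x g⁻¹`. -/
structure IsCovariantFamily {X : Type*} [MeasurableSpace X] [MulAction G X] (vol : Measure X)
    (U : G →* unitary (H →L[ℂ] H)) (ρ : X → H →L[ℂ] H) : Prop where
  isState : ∀ x, IsState (ρ x)
  measurable : AEStronglyMeasurable ρ vol
  covariant : ∀ (g : G) (x : X), ρ (g • x) = conjOp U g (ρ x)

end Representations

end

end RegionEstimation

/-! Both bounds rest on one dimension count. For a `K`-equivariant map `T` from `V_μ` to `H`, let
`Z` be the span of the vectors `g T v`. Restriction along `T` embeds `Hom_G(Z, V_λ)` into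
`Hom_K(V_μ, V_λ)`, and `Z` sits inside `H`, so `V_λ` occurs in `Z` at most `r^λ_μ` times and `dim Z
≤ ∑ d_λ r^λ_μ` (`finrank_genSub_le`). A `T` whose generated space has maximal dimension gives
equality (`exists_finrank_genSub_eq`). Let `M` be the largest branching sum.

Lower bound (`exists_state_le_beta`): the eigenspaces of a `K`-invariant `ρ` split into
`K`-irreducible pieces. Replacing the projection onto each piece by the projection onto the
`G`-space it generates gives a `G`-invariant `B ≥ ρ` with `tr B ≤ M` (`exists_invariant_ge`). With
`σ = B / tr B`, every test satisfies `tr(ρE) ≤ M tr(σE)`.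

Upper bound (`exists_state_beta_le`): take an optimal `T`, average `T T†` over `G` to `S`, and let
`R` be the inverse square root of `S` on its support. Then `A = R T T† R` averages to a projection
`P`, and by Schur's lemma `A` is `r` times a projection, with `r = rank P / d_μ` at least the
branching sum. The state `A / tr A` and the test `α A / r` give `β ≤ α / r`, because `tr(σA) =
tr(σP) ≤ 1` for `G`-invariant `σ`.

Estimators (`infSupBeta_successProb_le`): pulling all success effects back to `x₀` and averaging
over `G` gives one test. Its value in `ρ^{x₀}` is the success probability; in an invariant `σ`,
Fubini bounds it by `V_max / |X|`. -/

namespace RegionEstimation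

noncomputable section

open Representation

/-! ### Additivity of spaces of intertwining maps -/

section Intertwining

variable {G V W W' : Type*} [Group G] [AddCommGroup V] [Module ℂ V] [AddCommGroup W] [Module ℂ W]
  [AddCommGroup W'] [Module ℂ W']

/-- The inclusion of a subrepresentation. -/
def subIncl {π : Representation ℂ G V} (Z : Subrepresentation π) :
    IntertwiningMap Z.toRepresentation π :=
  Z.toSubmodule.subtype.intertwiningMap_of_isIntertwiningMap _ _ fun _ _ => rfl

/-- Restriction of the codomain of an intertwining map to a subrepresentation. -/
def codRestrictMap {π : Representation ℂ G V} {τ : Representation ℂ G W}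
    (Z : Subrepresentation π) (f : IntertwiningMap τ π) (h : ∀ w, f w ∈ Z.toSubmodule) :
    IntertwiningMap τ Z.toRepresentation :=
  (f.toLinearMap.codRestrict Z.toSubmodule h).intertwiningMap_of_isIntertwiningMap _ _
    fun g w => Subtype.ext (f.isIntertwining _ _ g w)

/-- Every subrepresentation is the image of an equivariant retraction. -/
def HasRetractions (π : Representation ℂ G V) : Prop :=
  ∀ Z : Subrepresentation π, ∃ p : IntertwiningMap π Z.toRepresentation,
    ∀ z : Z.toSubmodule, p z = z

theorem finrank_intertwiningMap_congr_left {ρ : Representation ℂ G V} {σ : Representation ℂ G W}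
    (e : ρ.Equiv σ) (τ : Representation ℂ G W') :
    Module.finrank ℂ (IntertwiningMap ρ τ) = Module.finrank ℂ (IntertwiningMap σ τ) :=
  LinearEquiv.finrank_eq
    { toFun := fun f => f.comp e.symm.toIntertwiningMap
      invFun := fun f => f.comp e.toIntertwiningMap
      map_add' := fun f g => IntertwiningMap.comp_add ..
      map_smul' := fun a f => IntertwiningMap.smul_comp ..
      left_inv := fun f => DFunLike.ext _ _ fun v => by simp
      right_inv := fun f => DFunLike.ext _ _ fun v => by simp }

theorem finrank_intertwiningMap_congr_right {ρ : Representation ℂ G V} {σ : Representation ℂ G W}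
    (e : ρ.Equiv σ) (τ : Representation ℂ G W') :
    Module.finrank ℂ (IntertwiningMap τ ρ) = Module.finrank ℂ (IntertwiningMap τ σ) :=
  LinearEquiv.finrank_eq
    { toFun := fun f => e.toIntertwiningMap.comp f
      invFun := fun f => e.symm.toIntertwiningMap.comp f
      map_add' := fun f g => IntertwiningMap.add_comp ..
      map_smul' := fun a f => IntertwiningMap.comp_smul ..
      left_inv := fun f => DFunLike.ext _ _ fun v => by simp
      right_inv := fun f => DFunLike.ext _ _ fun v => by simp }

theorem finrank_intertwiningMap_prod_left [FiniteDimensional ℂ V] [FiniteDimensional ℂ W]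
    [FiniteDimensional ℂ W'] (ρ : Representation ℂ G V) (σ : Representation ℂ G W)
    (τ : Representation ℂ G W') :
    Module.finrank ℂ (IntertwiningMap (ρ.prod σ) τ) =
      Module.finrank ℂ (IntertwiningMap ρ τ) + Module.finrank ℂ (IntertwiningMap σ τ) := by
  rw [← Module.finrank_prod]
  exact LinearEquiv.finrank_eq
    { toFun := fun f => (f.comp (IntertwiningMap.inl ℂ ρ σ), f.comp (IntertwiningMap.inr ℂ ρ σ))
      invFun := fun f => f.1.comp (IntertwiningMap.fst ℂ ρ σ) + f.2.comp (IntertwiningMap.snd ℂ ρ σ)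
      map_add' := fun f g => by simp [IntertwiningMap.comp_add]
      map_smul' := fun a f => by simp [IntertwiningMap.smul_comp]
      left_inv := fun f => DFunLike.ext _ _ fun v => by
        obtain ⟨v, w⟩ := v
        simp [← map_add, IntertwiningMap.inl, IntertwiningMap.inr, IntertwiningMap.prod]
      right_inv := fun f => by
        ext v <;> simp [IntertwiningMap.inl, IntertwiningMap.inr, IntertwiningMap.prod] }

theorem finrank_intertwiningMap_prod_right [FiniteDimensional ℂ V] [FiniteDimensional ℂ W]
    [FiniteDimensional ℂ W'] (ρ : Representation ℂ G V) (σ : Representation ℂ G W)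
    (τ : Representation ℂ G W') :
    Module.finrank ℂ (IntertwiningMap τ (ρ.prod σ)) =
      Module.finrank ℂ (IntertwiningMap τ ρ) + Module.finrank ℂ (IntertwiningMap τ σ) := by
  rw [← Module.finrank_prod]
  exact LinearEquiv.finrank_eq
    { toFun := fun f => ((IntertwiningMap.fst ℂ ρ σ).comp f, (IntertwiningMap.snd ℂ ρ σ).comp f)
      invFun := fun f => f.1.prod f.2
      map_add' := fun f g => by simp [IntertwiningMap.add_comp]
      map_smul' := fun a f => by simp [IntertwiningMap.comp_smul]
      left_inv := fun f => rfl
      right_inv := fun f => rfl }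

end Intertwining

/-! ### Complete reducibility as an induction principle -/

section Induction

variable {G V : Type*} [Group G] [AddCommGroup V] [Module ℂ V] {π : Representation ℂ G V}

theorem isIrreducible_toRepresentation (Z : Subrepresentation π) (hZ : Z ≠ ⊥)
    (h : ∀ Y : Subrepresentation π, Y.toSubmodule ≤ Z.toSubmodule → Y = ⊥ ∨ Y = Z) :
    Z.toRepresentation.IsIrreducible := by
  refine { exists_pair_ne := ⟨⊥, ⊤, fun hbt => hZ ?_⟩, eq_bot_or_eq_top := fun X => ?_ }
  · refine Subrepresentation.toSubmodule_injective (eq_bot_iff.2 fun v hv => ?_)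
    have : (⟨v, hv⟩ : Z.toSubmodule) ∈ (⊥ : Subrepresentation Z.toRepresentation).toSubmodule := by
      rw [hbt]; exact Submodule.mem_top
    exact congrArg Subtype.val ((Submodule.mem_bot ℂ).1 this)
  · let Y : Subrepresentation π :=
      ⟨X.toSubmodule.map Z.toSubmodule.subtype, by
        rintro g _ ⟨v, hv, rfl⟩
        exact ⟨_, X.apply_mem_toSubmodule g hv, rfl⟩⟩
    have hY : Y.toSubmodule ≤ Z.toSubmodule := Submodule.map_subtype_le _ _
    rcases h Y hY with h | h
    · left
      refine Subrepresentation.toSubmodule_injective (eq_bot_iff.2 fun v hv => ?_)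
      have h1 : (v : V) ∈ Y.toSubmodule := ⟨v, hv, rfl⟩
      rw [h] at h1
      exact (Submodule.mem_bot ℂ).2 (Subtype.ext ((Submodule.mem_bot ℂ).1 h1))
    · right
      refine Subrepresentation.toSubmodule_injective (eq_top_iff.2 fun v _ => ?_)
      have h1 : (v : V) ∈ Y.toSubmodule := by rw [h]; exact v.2
      obtain ⟨w, hw, hwv⟩ := h1
      exact (Subtype.ext hwv : w = v) ▸ hw

variable [FiniteDimensional ℂ V]

/-- Every nonzero subrepresentation contains an irreducible one. -/
theorem exists_irreducible_le (Z : Subrepresentation π) (hZ : Z ≠ ⊥) :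
    ∃ W : IrredSub π, W.1.toSubmodule ≤ Z.toSubmodule := by
  induction hn : Module.finrank ℂ Z.toSubmodule using Nat.strong_induction_on generalizing Z with
  | _ n ih =>
    by_cases h : ∀ Y : Subrepresentation π, Y.toSubmodule ≤ Z.toSubmodule → Y = ⊥ ∨ Y = Z
    · exact ⟨⟨Z, isIrreducible_toRepresentation Z hZ h⟩, le_rfl⟩
    · push Not at h
      obtain ⟨Y, hY, h0, h1⟩ := h
      have hlt : Y.toSubmodule < Z.toSubmodule :=
        lt_of_le_of_ne hY fun h => h1 (Subrepresentation.toSubmodule_injective h)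
      obtain ⟨W, hW⟩ := ih _ (hn ▸ Submodule.finrank_lt_finrank_of_lt hlt) Y h0 rfl
      exact ⟨W, hW.trans hY⟩

/-- A retraction `p` onto an irreducible `W ≤ Z` splits `Z` as `W ⊕ (Z ⊓ ker p)`, and the second
summand is strictly smaller. Quantities additive over direct sums can thus be computed from
irreducibles alone. -/
theorem HasRetractions.induction (hπ : HasRetractions π) (P : Subrepresentation π → Prop)
    (bot : P ⊥)
    (step : ∀ (W : IrredSub π) (Z' Z : Subrepresentation π),
      Z.toRepresentation.Equiv (W.1.toRepresentation.prod Z'.toRepresentation) → P Z' → P Z)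
    (Z : Subrepresentation π) : P Z := by
  induction hn : Module.finrank ℂ Z.toSubmodule using Nat.strong_induction_on generalizing Z with
  | _ n ih =>
    by_cases hZ : Z = ⊥
    · exact hZ ▸ bot
    obtain ⟨W, hW⟩ := exists_irreducible_le Z hZ
    obtain ⟨p, hp⟩ := hπ W.1
    let q := p.comp (subIncl Z)
    let Z' : Subrepresentation π := Z ⊓ p.ker
    have hr : ∀ z : Z.toSubmodule, (z : V) - (p (z : V) : W.1.toSubmodule) ∈ Z'.toSubmodule :=
      fun z => ⟨sub_mem z.2 (hW (Subtype.prop _)), by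
        change p _ = 0
        rw [map_sub, hp, sub_self]⟩
    let r : IntertwiningMap Z.toRepresentation Z'.toRepresentation :=
      codRestrictMap Z' (subIncl Z - (subIncl W.1).comp q) hr
    have hr' : ∀ z : Z.toSubmodule, (r z : V) = (z : V) - (p (z : V) : W.1.toSubmodule) :=
      fun _ => rfl
    have hb : Function.Bijective (q.prod r) := by
      constructor
      · intro y z hyz
        obtain ⟨h1, h2⟩ := Prod.ext_iff.1 hyz
        replace h1 : p (y : V) = p (z : V) := h1
        replace h2 : (r y : V) = r z := congrArg Subtype.val h2
        rw [hr', hr', h1] at h2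
        exact Subtype.ext (sub_left_injective h2)
      · rintro ⟨w, z⟩
        have hz : p (z : V) = 0 := z.2.2
        have hpw : p ((w : V) + z) = w := by rw [map_add, hp, hz, add_zero]
        refine ⟨⟨(w : V) + z, add_mem (hW w.2) z.2.1⟩, Prod.ext hpw (Subtype.ext ?_)⟩
        change (r _ : V) = z
        rw [hr', hpw]
        simp
    have hlt : Module.finrank ℂ Z'.toSubmodule < n := by
      rw [← hn]
      refine Submodule.finrank_lt_finrank_of_lt (lt_of_le_of_ne inf_le_left fun h => ?_)
      have := W.2
      obtain ⟨Y, hY⟩ := exists_ne (⊥ : Subrepresentation W.1.toRepresentation)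
      obtain ⟨y, hy, hy0⟩ := Submodule.exists_mem_ne_zero_of_ne_bot
        fun h => hY (Subrepresentation.toSubmodule_injective h)
      have h1 : (y : V) ∈ Z'.toSubmodule := h ▸ hW y.2
      exact hy0 ((hp y).symm.trans h1.2)
    exact step W Z' Z ((q.prod r).ofBijective hb) (ih _ hlt Z' rfl)

end Induction

/-! ### Multiplicities and the isotypic dimension formula -/

section Dimension

variable {G V : Type*} [Group G] [AddCommGroup V] [Module ℂ V] {π : Representation ℂ G V}

instance Isotype.isIrreducible_rep (l : Isotype π) : l.rep.IsIrreducible := (Quotient.out l).2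

/-- The isomorphism class of an irreducible subrepresentation. -/
abbrev Isotype.mk (W : IrredSub π) : Isotype π := Quotient.mk (irredSetoid π) W

theorem Isotype.nonempty_equiv_mk (W : IrredSub π) :
    Nonempty ((Isotype.mk W).rep.Equiv W.1.toRepresentation) :=
  Quotient.mk_out (s := irredSetoid π) W

variable [FiniteDimensional ℂ V]

theorem Isotype.dim_pos (l : Isotype π) : 0 < l.dim := by
  obtain ⟨Y, hY⟩ := exists_ne (⊥ : Subrepresentation l.rep)
  obtain ⟨y, -, hy0⟩ := Submodule.exists_mem_ne_zero_of_ne_bot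
    fun h => hY (Subrepresentation.toSubmodule_injective h)
  exact Module.finrank_pos_iff_exists_ne_zero.2 ⟨y, hy0⟩

omit [FiniteDimensional ℂ V] in
theorem Isotype.dim_mk (W : IrredSub π) :
    (Isotype.mk W).dim = Module.finrank ℂ W.1.toSubmodule := by
  obtain ⟨e⟩ := Isotype.nonempty_equiv_mk W
  exact e.toLinearEquiv.finrank_eq

open Classical in
theorem Isotype.finrank_irredSub_left (W : IrredSub π) (l : Isotype π) :
    Module.finrank ℂ (IntertwiningMap W.1.toRepresentation l.rep) =
      if l = Isotype.mk W then 1 else 0 := by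
  have := W.2
  split_ifs with h
  · subst h
    obtain ⟨e⟩ := Isotype.nonempty_equiv_mk W
    rw [← finrank_intertwiningMap_congr_left e]
    exact IsIrreducible.finrank_intertwiningMap_self _
  · have : IsEmpty (Equiv W.1.toRepresentation l.rep) :=
      ⟨fun e => h ((Quotient.out_eq l).symm.trans (Quotient.sound ⟨e.symm⟩))⟩
    exact Module.finrank_zero_of_subsingleton

open Classical in
theorem Isotype.finrank_irredSub_right (W : IrredSub π) (l : Isotype π) :
    Module.finrank ℂ (IntertwiningMap l.rep W.1.toRepresentation) =
      if l = Isotype.mk W then 1 else 0 := by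
  have := W.2
  split_ifs with h
  · subst h
    obtain ⟨e⟩ := Isotype.nonempty_equiv_mk W
    rw [← finrank_intertwiningMap_congr_right e]
    exact IsIrreducible.finrank_intertwiningMap_self _
  · have : IsEmpty (Equiv l.rep W.1.toRepresentation) :=
      ⟨fun e => h ((Quotient.out_eq l).symm.trans (Quotient.sound ⟨e⟩))⟩
    exact Module.finrank_zero_of_subsingleton

instance : Subsingleton (⊥ : Subrepresentation π).toSubmodule :=
  inferInstanceAs (Subsingleton (⊥ : Submodule ℂ V))

/-- Both sides are additive in `Z` and agree on irreducibles by Schur's lemma over `ℂ`.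
Multiplicities are defined by maps out of `V_λ`, while a generating map controls maps into `V_λ`;
this passes between the two. -/
theorem finrank_intertwiningMap_isotype_comm (hπ : HasRetractions π) (Z : Subrepresentation π)
    (l : Isotype π) :
    Module.finrank ℂ (IntertwiningMap l.rep Z.toRepresentation) =
      Module.finrank ℂ (IntertwiningMap Z.toRepresentation l.rep) := by
  induction Z using hπ.induction with
  | bot =>
    have h1 : Subsingleton (IntertwiningMap l.rep (⊥ : Subrepresentation π).toRepresentation) :=
      ⟨fun f g => DFunLike.ext _ _ fun v => Subsingleton.elim _ _⟩
    have h2 : Subsingleton (IntertwiningMap (⊥ : Subrepresentation π).toRepresentation l.rep) :=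
      ⟨fun f g => DFunLike.ext _ _ fun v => by rw [Subsingleton.elim v 0, map_zero, map_zero]⟩
    rw [Module.finrank_zero_of_subsingleton, Module.finrank_zero_of_subsingleton]
  | step W Z' Z e ih =>
    rw [finrank_intertwiningMap_congr_right e, finrank_intertwiningMap_congr_left e,
      finrank_intertwiningMap_prod_right, finrank_intertwiningMap_prod_left, ih,
      Isotype.finrank_irredSub_left, Isotype.finrank_irredSub_right]

/-- The dimension of a subrepresentation is the sum of the dimensions of its isotypic parts. -/
theorem finrank_eq_tsum_isotype (hπ : HasRetractions π) (Z : Subrepresentation π) :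
    (Module.finrank ℂ Z.toSubmodule : ℝ≥0∞) = ∑' l : Isotype π, (l.dim : ℝ≥0∞) *
      (Module.finrank ℂ (IntertwiningMap Z.toRepresentation l.rep) : ℕ) := by
  classical
  induction Z using hπ.induction with
  | bot =>
    have h2 (l : Isotype π) :
        Subsingleton (IntertwiningMap (⊥ : Subrepresentation π).toRepresentation l.rep) :=
      ⟨fun f g => DFunLike.ext _ _ fun v => by rw [Subsingleton.elim v 0, map_zero, map_zero]⟩
    simp [Module.finrank_zero_of_subsingleton]
  | step W Z' Z e ih =>
    have h (l : Isotype π) : Module.finrank ℂ (IntertwiningMap Z.toRepresentation l.rep) =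
        (if l = Isotype.mk W then 1 else 0) +
          Module.finrank ℂ (IntertwiningMap Z'.toRepresentation l.rep) := by
      rw [finrank_intertwiningMap_congr_left e, finrank_intertwiningMap_prod_left,
        Isotype.finrank_irredSub_left]
    have h' : Module.finrank ℂ Z.toSubmodule =
        Module.finrank ℂ W.1.toSubmodule + Module.finrank ℂ Z'.toSubmodule := by
      rw [e.toLinearEquiv.finrank_eq, Module.finrank_prod]
    rw [h', Nat.cast_add, ih]
    simp only [h, Nat.cast_add, mul_add, ENNReal.tsum_add]
    congr 1
    rw [tsum_eq_single (Isotype.mk W) fun l hl => by simp [hl], Isotype.dim_mk]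
    simp

/-- Each isotype contributes at least `1` to the dimension formula for the whole space, whose total
is finite. -/
theorem finite_isotype (hπ : HasRetractions π) : Finite (Isotype π) := by
  have h1 := finrank_eq_tsum_isotype hπ (⊤ : Subrepresentation π)
  have h2 (l : Isotype π) : (1 : ℝ≥0∞) ≤ (l.dim : ℝ≥0∞) *
      (Module.finrank ℂ (IntertwiningMap (⊤ : Subrepresentation π).toRepresentation l.rep) :
        ℕ) := by
    rw [← finrank_intertwiningMap_isotype_comm hπ]
    have : 0 < Module.finrank ℂ
        (IntertwiningMap l.rep (⊤ : Subrepresentation π).toRepresentation) := by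
      obtain ⟨y, hy⟩ := Module.finrank_pos_iff_exists_ne_zero.1 l.dim_pos
      refine Module.finrank_pos_iff_exists_ne_zero.2
        ⟨codRestrictMap ⊤ (subIncl _) fun _ => Submodule.mem_top, fun h => hy (Subtype.ext ?_)⟩
      have := DFunLike.congr_fun h y
      exact congrArg (fun z => ((z : (⊤ : Subrepresentation π).toSubmodule) : V)) this
    exact_mod_cast Nat.mul_pos l.dim_pos this
  have h3 := ENNReal.finite_const_le_of_tsum_ne_top (h1 ▸ ENNReal.natCast_ne_top _) one_ne_zero
  refine Set.finite_univ_iff.1 (h3.subset fun l _ => h2 l)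

theorem nonempty_isotype [Nontrivial V] (π : Representation ℂ G V) : Nonempty (Isotype π) := by
  obtain ⟨W, -⟩ := exists_irreducible_le (⊤ : Subrepresentation π) fun h => by
    obtain ⟨v, hv⟩ := exists_ne (0 : V)
    have : v ∈ (⊤ : Subrepresentation π).toSubmodule := Submodule.mem_top
    rw [h] at this
    exact hv ((Submodule.mem_bot ℂ).1 this)
  exact ⟨Isotype.mk W⟩

end Dimension

/-! ### Subrepresentations generated by a `K`-equivariant map -/

section Generation

variable {G V V₀ V₁ : Type*} [Group G] [AddCommGroup V] [Module ℂ V] [AddCommGroup V₀] [Module ℂ V₀]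
  [AddCommGroup V₁] [Module ℂ V₁]
  {π : Representation ℂ G V} {K : Subgroup G} {τ : Representation ℂ K V₀}

/-- The subrepresentation of `π` generated by the range of a `K`-equivariant map. -/
def genSub (T : IntertwiningMap τ (restrictRep π K)) : Subrepresentation π where
  toSubmodule := Submodule.span ℂ (Set.range fun p : G × V₀ => π p.1 (T p.2))
  apply_mem_toSubmodule g v hv := by
    induction hv using Submodule.span_induction with
    | mem x hx =>
      obtain ⟨⟨h, w⟩, rfl⟩ := hx
      refine Submodule.subset_span ⟨(g * h, w), ?_⟩
      simp
    | zero => simp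
    | add x y _ _ hx hy => rw [map_add]; exact add_mem hx hy
    | smul a x _ hx => rw [map_smul]; exact Submodule.smul_mem _ _ hx

variable (T : IntertwiningMap τ (restrictRep π K))

theorem apply_mem_genSub (w : V₀) : T w ∈ (genSub T).toSubmodule :=
  Submodule.subset_span ⟨(1, w), by simp⟩

theorem genSub_le {T : IntertwiningMap τ (restrictRep π K)} {Z : Subrepresentation π}
    (h : ∀ w, T w ∈ Z.toSubmodule) : (genSub T).toSubmodule ≤ Z.toSubmodule :=
  Submodule.span_le.2 fun _ ⟨⟨g, w⟩, hg⟩ => hg ▸ Z.apply_mem_toSubmodule g (h w)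

/-- The generating map, with values in the generated subrepresentation. -/
def genMap : IntertwiningMap τ (restrictRep (genSub T).toRepresentation K) :=
  (T.toLinearMap.codRestrict _ (apply_mem_genSub T)).intertwiningMap_of_isIntertwiningMap _ _
    fun k w => Subtype.ext (T.isIntertwining _ _ k w)

@[simp]
theorem coe_genMap_apply (w : V₀) : (genMap T w : V) = T w := rfl

/-- The kernel of `f - g` is `G`-stable and contains the generators, hence is everything. -/
theorem genSub_hom_ext {σ : Representation ℂ G V₁}
    {f g : IntertwiningMap (genSub T).toRepresentation σ}
    (h : ∀ w, f (genMap T w) = g (genMap T w)) : f = g := by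
  let Z : Subrepresentation π :=
    ⟨(f - g).ker.toSubmodule.map (genSub T).toSubmodule.subtype, by
      rintro a _ ⟨v, hv, rfl⟩
      exact ⟨_, (f - g).ker.apply_mem_toSubmodule a hv, rfl⟩⟩
  have hZ := genSub_le (T := T) (Z := Z) fun w => ⟨genMap T w, sub_eq_zero.2 (h w), rfl⟩
  refine DFunLike.ext _ _ fun v => ?_
  obtain ⟨v', hv', he⟩ := hZ v.2
  rw [← (Subtype.ext he : v' = v)]
  exact sub_eq_zero.1 hv'

/-- Restriction of an intertwining map to a subgroup. -/
def restrictMap {σ : Representation ℂ G V₁} (K : Subgroup G) (f : IntertwiningMap π σ) :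
    IntertwiningMap (restrictRep π K) (restrictRep σ K) :=
  f.toLinearMap.intertwiningMap_of_isIntertwiningMap _ _ fun k v => f.isIntertwining _ _ k v

/-- Composition with the generating map. -/
def compGenMap (σ : Representation ℂ G V₁) :
    IntertwiningMap (genSub T).toRepresentation σ →ₗ[ℂ] IntertwiningMap τ (restrictRep σ K) where
  toFun f := (restrictMap K f).comp (genMap T)
  map_add' _ _ := rfl
  map_smul' _ _ := rfl

theorem compGenMap_injective (σ : Representation ℂ G V₁) :
    Function.Injective (compGenMap T σ) :=
  fun _ _ h => genSub_hom_ext T fun w => DFunLike.congr_fun h w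

variable [FiniteDimensional ℂ V] [FiniteDimensional ℂ V₀]

/-- The two bounds come from two injections: restriction along the generating map, and, after
reversing the direction of the maps, inclusion into `π`. -/
theorem finrank_genSub_hom_le (hπ : HasRetractions π) (l : Isotype π) :
    Module.finrank ℂ (IntertwiningMap (genSub T).toRepresentation l.rep) ≤
      min (multiplicity τ (restrictRep l.rep K)) (multiplicity l.rep π) := by
  refine le_min (LinearMap.finrank_le_finrank_of_injective (compGenMap_injective T l.rep)) ?_
  rw [← finrank_intertwiningMap_isotype_comm hπ]
  let f : IntertwiningMap l.rep (genSub T).toRepresentation →ₗ[ℂ] IntertwiningMap l.rep π :=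
    { toFun := fun f => (subIncl _).comp f
      map_add' := fun _ _ => rfl
      map_smul' := fun _ _ => rfl }
  refine LinearMap.finrank_le_finrank_of_injective (f := f) fun a b h => ?_
  exact DFunLike.ext _ _ fun v => Subtype.ext (DFunLike.congr_fun h v)

theorem finrank_genSub_le (hπ : HasRetractions π) :
    (Module.finrank ℂ (genSub T).toSubmodule : ℝ≥0∞) ≤ ∑' l : Isotype π, (l.dim : ℝ≥0∞) *
      (min (multiplicity τ (restrictRep l.rep K)) (multiplicity l.rep π) : ℕ) := by
  rw [finrank_eq_tsum_isotype hπ]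
  exact ENNReal.tsum_le_tsum fun l =>
    mul_le_mul_right (Nat.cast_le.2 (finrank_genSub_hom_le T hπ l)) _

omit [FiniteDimensional ℂ V] in
/-- A nonzero map from an irreducible representation has an equivariant left inverse. -/
theorem exists_leftInverse (hπ : HasRetractions π) {σ : Representation ℂ G V₁} [σ.IsIrreducible]
    (f : IntertwiningMap σ π) (hf : f ≠ 0) :
    ∃ q : IntertwiningMap π σ, ∀ v, q (f v) = v := by
  obtain ⟨p, hp⟩ := hπ f.range
  have hinj := (IsIrreducible.injective_or_eq_zero f).resolve_right hf
  let f' := codRestrictMap f.range f fun w => ⟨w, rfl⟩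
  have hb : Function.Bijective f' :=
    ⟨fun a b h => hinj (congrArg Subtype.val h), fun ⟨_, w, hw⟩ => ⟨w, Subtype.ext hw⟩⟩
  refine ⟨(f'.ofBijective hb).symm.toIntertwiningMap.comp p, fun v => ?_⟩
  change (f'.ofBijective hb).symm (p (f' v : V)) = v
  rw [hp]
  exact (f'.ofBijective hb).symm_apply_apply v

omit [FiniteDimensional ℂ V₀] in
-- Slack in the isotype `l` provides two things: a `K`-map `j` into `V_l` that is not the
-- restriction of a `G`-map on `genSub T`, and a copy `f` of `V_l` in the kernel of a retraction
-- onto `genSub T`. The perturbation `T + f ∘ j` generates more, since equality of dimensions would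
-- extend `j`.
theorem exists_finrank_genSub_lt (hπ : HasRetractions π) (l : Isotype π)
    (h : Module.finrank ℂ (IntertwiningMap (genSub T).toRepresentation l.rep) <
      min (multiplicity τ (restrictRep l.rep K)) (multiplicity l.rep π)) :
    ∃ T' : IntertwiningMap τ (restrictRep π K),
      Module.finrank ℂ (genSub T).toSubmodule < Module.finrank ℂ (genSub T').toSubmodule := by
  obtain ⟨h1, h2⟩ := lt_min_iff.1 h
  obtain ⟨j, hj⟩ : ∃ j, j ∉ LinearMap.range (compGenMap T l.rep) := by
    by_contra! hc
    refine h1.not_ge ?_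
    rw [← LinearMap.finrank_range_of_inj (compGenMap_injective T l.rep),
      LinearMap.range_eq_top.2 hc, finrank_top]
    rfl
  obtain ⟨p, hp⟩ := hπ (genSub T)
  obtain ⟨f, hf, hf0⟩ : ∃ f : IntertwiningMap l.rep π, p.comp f = 0 ∧ f ≠ 0 := by
    rw [← finrank_intertwiningMap_isotype_comm hπ] at h2
    let c : IntertwiningMap l.rep π →ₗ[ℂ] IntertwiningMap l.rep (genSub T).toRepresentation :=
      { toFun := fun f => p.comp f
        map_add' := fun _ _ => IntertwiningMap.add_comp ..
        map_smul' := fun _ _ => IntertwiningMap.comp_smul .. }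
    by_contra! hc
    exact h2.not_ge (LinearMap.finrank_le_finrank_of_injective (f := c)
      (LinearMap.ker_eq_bot.1 (LinearMap.ker_eq_bot'.2 hc)))
  obtain ⟨q, hq⟩ := exists_leftInverse hπ f hf0
  let T' : IntertwiningMap τ (restrictRep π K) := T + (restrictMap K f).comp j
  have hpf : ∀ v, p (f v) = 0 := fun v => DFunLike.congr_fun hf v
  have hT' : ∀ w, T' w = T w + f (j w) := fun _ => rfl
  have hpT : ∀ w, p (T' w) = genMap T w := fun w => by
    rw [hT', map_add, hpf, add_zero]
    exact hp (genMap T w)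
  let p' := p.comp (subIncl (genSub T'))
  have hsurj : Function.Surjective p' := by
    have : (genSub T).toSubmodule ≤ ((subIncl (genSub T)).comp p').range.toSubmodule :=
      genSub_le fun w => ⟨genMap T' w, congrArg Subtype.val (hpT w)⟩
    intro z
    obtain ⟨y, hy⟩ := this z.2
    exact ⟨y, Subtype.ext hy⟩
  refine ⟨T', lt_of_le_of_ne (LinearMap.finrank_le_finrank_of_surjective
    (f := p'.toLinearMap) hsurj) fun heq => hj ?_⟩
  -- Assuming equal dimensions, `p'` is an isomorphism. Following its inverse by the complementary
  -- projection `r` and by the left inverse `q` of `f` gives a `G`-map restricting to `j`, contrary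
  -- to the choice of `j`.
  have hinj : Function.Injective p' :=
    (LinearMap.injective_iff_surjective_of_finrank_eq_finrank
      (f := p'.toLinearMap) heq.symm).2 hsurj
  let e := p'.ofBijective ⟨hinj, hsurj⟩
  let r : IntertwiningMap π π := IntertwiningMap.id π - (subIncl _).comp p
  refine ⟨(q.comp r).comp ((subIncl (genSub T')).comp e.symm.toIntertwiningMap), ?_⟩
  refine DFunLike.ext _ _ fun w => ?_
  have he : e.symm (genMap T w) = genMap T' w := by
    rw [← hpT w]; exact e.symm_apply_apply (genMap T' w)
  change q (r (e.symm (genMap T w) : (genSub T').toSubmodule)) = j w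
  rw [he]
  change q (T' w - (p (T' w) : (genSub T).toSubmodule)) = j w
  rw [hpT, hT', coe_genMap_apply, add_sub_cancel_left, hq]

/-- A `T` of maximal generated dimension saturates every isotype at once, since slack in any of them
would allow an increase. -/
theorem exists_finrank_genSub_eq (hπ : HasRetractions π) (τ : Representation ℂ K V₀) :
    ∃ T : IntertwiningMap τ (restrictRep π K),
      (Module.finrank ℂ (genSub T).toSubmodule : ℝ≥0∞) = ∑' l : Isotype π, (l.dim : ℝ≥0∞) *
        (min (multiplicity τ (restrictRep l.rep K)) (multiplicity l.rep π) : ℕ) := by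
  let S := Set.range fun T : IntertwiningMap τ (restrictRep π K) =>
    Module.finrank ℂ (genSub T).toSubmodule
  have hS : BddAbove S := ⟨Module.finrank ℂ V, by
    rintro _ ⟨T, rfl⟩
    exact Submodule.finrank_le _⟩
  obtain ⟨T, hT⟩ : sSup S ∈ S := Nat.sSup_mem ⟨_, 0, rfl⟩ hS
  refine ⟨T, ?_⟩
  rw [finrank_eq_tsum_isotype hπ]
  refine tsum_congr fun l => ?_
  congr 2
  refine (finrank_genSub_hom_le T hπ l).eq_of_not_lt fun hlt => ?_
  obtain ⟨T', hT'⟩ := exists_finrank_genSub_lt T hπ l hlt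
  exact hT'.not_ge ((le_csSup hS ⟨T', rfl⟩).trans_eq hT.symm)

end Generation

/-! ### Branching sums as dimensions of generated subspaces -/

section Branching

variable {G V : Type*} [Group G] [AddCommGroup V] [Module ℂ V] [FiniteDimensional ℂ V]
  (π : Representation ℂ G V) (K : Subgroup G)

omit [FiniteDimensional ℂ V] in
theorem branchingSum_eq_div (m : Isotype (restrictRep π K)) :
    branchingSum π K m = (∑' l : Isotype π, (l.dim : ℝ≥0∞) *
      (min (multiplicity m.rep (restrictRep l.rep K)) (multiplicity l.rep π) : ℕ)) / m.dim := by
  simp only [branchingSum, div_eq_mul_inv, ENNReal.tsum_mul_right]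

variable {π K}

theorem finrank_genSub_le_dim_mul (hπ : HasRetractions π) (m : Isotype (restrictRep π K))
    (T : IntertwiningMap m.rep (restrictRep π K)) :
    (Module.finrank ℂ (genSub T).toSubmodule : ℝ≥0∞) ≤ m.dim * branchingSum π K m := by
  rw [branchingSum_eq_div, ENNReal.mul_div_cancel (by simpa using m.dim_pos.ne') (by simp)]
  exact finrank_genSub_le T hπ

theorem exists_finrank_genSub_eq_dim_mul (hπ : HasRetractions π)
    (m : Isotype (restrictRep π K)) : ∃ T : IntertwiningMap m.rep (restrictRep π K),
      (Module.finrank ℂ (genSub T).toSubmodule : ℝ≥0∞) = m.dim * branchingSum π K m := by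
  rw [branchingSum_eq_div, ENNReal.mul_div_cancel (by simpa using m.dim_pos.ne') (by simp)]
  exact exists_finrank_genSub_eq hπ m.rep

/-- Every irreducible `K`-invariant subspace is contained in a `G`-invariant one whose dimension
is controlled by the branching sum. -/
theorem exists_subrepresentation_ge (hπ : HasRetractions π) (W : IrredSub (restrictRep π K)) :
    ∃ Z : Subrepresentation π, W.1.toSubmodule ≤ Z.toSubmodule ∧
      (Module.finrank ℂ Z.toSubmodule : ℝ≥0∞) ≤
        Module.finrank ℂ W.1.toSubmodule * branchingSum π K (Isotype.mk W) := by
  obtain ⟨e⟩ := Isotype.nonempty_equiv_mk W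
  let T := (subIncl W.1).comp e.toIntertwiningMap
  refine ⟨genSub T, fun w hw => ?_, ?_⟩
  · have h := apply_mem_genSub T (e.symm ⟨w, hw⟩)
    have h2 : T (e.symm ⟨w, hw⟩) = w := congrArg Subtype.val (e.apply_symm_apply ⟨w, hw⟩)
    rwa [h2] at h
  · rw [← Isotype.dim_mk]
    exact finrank_genSub_le_dim_mul hπ _ T

/-- The inclusion of the representative of `m` generates a nonzero space, whose dimension is at most
`d_m` times the branching sum. -/
theorem branchingSum_pos (hπ : HasRetractions π) (m : Isotype (restrictRep π K)) :
    0 < branchingSum π K m := by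
  have h := finrank_genSub_le_dim_mul hπ m (subIncl _)
  obtain ⟨y, hy⟩ := Module.finrank_pos_iff_exists_ne_zero.1 m.dim_pos
  refine pos_iff_ne_zero.2 fun h0 => ?_
  rw [h0, mul_zero, nonpos_iff_eq_zero, Nat.cast_eq_zero] at h
  have := apply_mem_genSub (subIncl (Quotient.out m).1) y
  rw [Submodule.finrank_eq_zero.1 h] at this
  exact hy (Subtype.ext ((Submodule.mem_bot ℂ).1 this))

theorem branchingSum_ne_top (hπ : HasRetractions π) (m : Isotype (restrictRep π K)) :
    branchingSum π K m ≠ ⊤ := by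
  obtain ⟨T, hT⟩ := exists_finrank_genSub_eq_dim_mul hπ m
  intro h
  rw [h, ENNReal.mul_top (by simpa using m.dim_pos.ne')] at hT
  exact ENNReal.natCast_ne_top _ hT

/-- For the trivial group irreducibles are one-dimensional and every linear map is equivariant, so
`m^λ_μ = d_λ`. -/
theorem branchingSum_of_eq_bot (hK : K = ⊥) (m : Isotype (restrictRep π K)) :
    branchingSum π K m = groupSum π := by
  have hs : Subsingleton K := by subst hK; infer_instance
  have : IsMulCommutative K := ⟨⟨fun a b => Subsingleton.elim _ _⟩⟩
  have hd : Module.finrank ℂ m.space = 1 :=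
    IsIrreducible.finrank_eq_one_of_isMulCommutative m.rep
  have hm (l : Isotype π) : multiplicity m.rep (restrictRep l.rep K) = l.dim := by
    let e : IntertwiningMap m.rep (restrictRep l.rep K) ≃ₗ[ℂ] (m.space →ₗ[ℂ] l.space) :=
      { toFun := fun f => f.toLinearMap
        invFun := fun f => f.intertwiningMap_of_isIntertwiningMap _ _ fun k v => by
          rw [Subsingleton.elim k 1, map_one, map_one]; rfl
        map_add' := fun _ _ => rfl
        map_smul' := fun _ _ => rfl
        left_inv := fun _ => rfl
        right_inv := fun _ => rfl }
    rw [multiplicity, e.finrank_eq, Module.finrank_linearMap, hd, one_mul]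
    rfl
  have hd' : m.dim = 1 := hd
  simp only [branchingSum, groupSum, hm, hd', Nat.cast_one, div_one]

end Branching

/-! ### Traces and expectation values -/

section Operators

variable {H : Type*} [NormedAddCommGroup H] [InnerProductSpace ℂ H]

/-- The trace of an operator. -/
abbrev opTrace (A : H →L[ℂ] H) : ℂ := LinearMap.trace ℂ H (A : H →ₗ[ℂ] H)

theorem opTrace_mul_comm (A B : H →L[ℂ] H) : opTrace (A * B) = opTrace (B * A) :=
  LinearMap.trace_mul_comm ℂ (A : H →ₗ[ℂ] H) (B : H →ₗ[ℂ] H)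

theorem expVal_eq (A E : H →L[ℂ] H) : expVal A E = (opTrace (A * E)).re := rfl

theorem expVal_comm (A B : H →L[ℂ] H) : expVal A B = expVal B A := by
  rw [expVal_eq, opTrace_mul_comm, expVal_eq]

theorem expVal_add_right (A B C : H →L[ℂ] H) : expVal A (B + C) = expVal A B + expVal A C := by
  rw [expVal_eq, mul_add, opTrace, ContinuousLinearMap.toLinearMap_add, map_add, Complex.add_re]
  rfl

theorem expVal_smul_right (A B : H →L[ℂ] H) (r : ℝ) : expVal A (r • B) = r * expVal A B := by
  have : (((A * r • B : H →L[ℂ] H)) : H →ₗ[ℂ] H) = (r : ℂ) • ((A * B : H →L[ℂ] H) : H →ₗ[ℂ] H) := by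
    ext v; simp
  rw [expVal_eq, opTrace, this, map_smul, smul_eq_mul, Complex.re_ofReal_mul]
  rfl

theorem expVal_smul_left (A B : H →L[ℂ] H) (r : ℝ) : expVal (r • A) B = r * expVal A B := by
  rw [expVal_comm, expVal_smul_right, expVal_comm]

theorem expVal_sub_right (A B C : H →L[ℂ] H) : expVal A (B - C) = expVal A B - expVal A C := by
  rw [sub_eq_add_neg, expVal_add_right, ← neg_one_smul ℝ C, expVal_smul_right]
  ring

theorem expVal_one_left (A : H →L[ℂ] H) : expVal 1 A = (opTrace A).re := by
  rw [expVal_eq, one_mul]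

variable [FiniteDimensional ℂ H]

omit [FiniteDimensional ℂ H] in
theorem opTrace_re_nonneg {A : H →L[ℂ] H} (hA : 0 ≤ A) : 0 ≤ (opTrace A).re := by
  have h : ((A : H →ₗ[ℂ] H)).IsPositive :=
    (ContinuousLinearMap.isPositive_toLinearMap_iff A).2
      ((ContinuousLinearMap.nonneg_iff_isPositive A).1 hA)
  exact (Complex.le_def.1 h.trace_nonneg).1

variable [CompleteSpace H]

omit [FiniteDimensional ℂ H] in
-- Writing `E = C† C`, cyclicity turns the trace into that of the positive operator `C A C†`.
theorem expVal_nonneg {A E : H →L[ℂ] H} (hA : 0 ≤ A) (hE : 0 ≤ E) : 0 ≤ expVal A E := by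
  obtain ⟨C, rfl⟩ := CStarAlgebra.nonneg_iff_eq_star_mul_self.1 hE
  rw [expVal_eq, ← mul_assoc, opTrace_mul_comm, ← mul_assoc]
  exact opTrace_re_nonneg (star_right_conjugate_nonneg hA C)

omit [FiniteDimensional ℂ H] in
theorem expVal_mono_right {A E F : H →L[ℂ] H} (hA : 0 ≤ A) (h : E ≤ F) :
    expVal A E ≤ expVal A F := by
  have := expVal_nonneg hA (sub_nonneg.2 h)
  rw [expVal_sub_right] at this
  linarith

omit [FiniteDimensional ℂ H] in
theorem expVal_mono_left {A B E : H →L[ℂ] H} (hE : 0 ≤ E) (h : A ≤ B) :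
    expVal A E ≤ expVal B E := by
  rw [expVal_comm A, expVal_comm B]
  exact expVal_mono_right hE h

omit [FiniteDimensional ℂ H] [CompleteSpace H] in
theorem IsState.expVal_one {A : H →L[ℂ] H} (hA : IsState A) : expVal A 1 = 1 := by
  rw [expVal_eq, mul_one, opTrace, hA.trace_eq_one, Complex.one_re]

omit [FiniteDimensional ℂ H] in
theorem IsState.expVal_le_one {A E : H →L[ℂ] H} (hA : IsState A) (hE : E ≤ 1) :
    expVal A E ≤ 1 :=
  (expVal_mono_right hA.nonneg hE).trans_eq hA.expVal_one

omit [FiniteDimensional ℂ H] [CompleteSpace H] in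
theorem opTrace_im_eq_zero {A : H →L[ℂ] H} (hA : 0 ≤ A) : (opTrace A).im = 0 := by
  have h : ((A : H →ₗ[ℂ] H)).IsPositive :=
    (ContinuousLinearMap.isPositive_toLinearMap_iff A).2
      ((ContinuousLinearMap.nonneg_iff_isPositive A).1 hA)
  exact (Complex.le_def.1 h.trace_nonneg).2.symm

omit [FiniteDimensional ℂ H] [CompleteSpace H] in
theorem isState_iff {A : H →L[ℂ] H} : IsState A ↔ 0 ≤ A ∧ (opTrace A).re = 1 :=
  ⟨fun h => ⟨h.nonneg, by rw [opTrace, h.trace_eq_one, Complex.one_re]⟩,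
    fun h => ⟨h.1, Complex.ext h.2 (opTrace_im_eq_zero h.1)⟩⟩

omit [CompleteSpace H] in
theorem opTrace_of_isIdempotentElem {P : H →L[ℂ] H} (hP : IsIdempotentElem P) :
    opTrace P = (Module.finrank ℂ P.range : ℂ) := by
  refine LinearMap.IsProj.trace ⟨fun v => ⟨v, rfl⟩, ?_⟩
  rintro _ ⟨v, rfl⟩
  exact DFunLike.congr_fun hP.eq v

theorem opTrace_starProjection (W : Submodule ℂ H) :
    opTrace W.starProjection = (Module.finrank ℂ W : ℂ) := by
  rw [opTrace_of_isIdempotentElem (isStarProjection_starProjection (U := W)).isIdempotentElem,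
    Submodule.range_starProjection]

end Operators

/-! ### Unitary representations and invariant majorants -/

section Unitary

variable {G : Type*} [Group G] {H : Type*} [NormedAddCommGroup H] [InnerProductSpace ℂ H]
  [CompleteSpace H] (U : G →* unitary (H →L[ℂ] H))

theorem unitary_mul_inv (g : G) : (U g : H →L[ℂ] H) * (U g⁻¹ : H →L[ℂ] H) = 1 := by
  rw [← Submonoid.coe_mul, ← map_mul]; simp

theorem unitary_inv_mul (g : G) : (U g⁻¹ : H →L[ℂ] H) * (U g : H →L[ℂ] H) = 1 := by
  rw [← Submonoid.coe_mul, ← map_mul]; simp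

theorem star_unitary (g : G) : star (U g : H →L[ℂ] H) = (U g⁻¹ : H →L[ℂ] H) := by
  rw [map_inv, ← Unitary.star_eq_inv, Unitary.coe_star]

theorem inner_unitary_left (g : G) (v w : H) :
    inner ℂ ((U g : H →L[ℂ] H) v) w = inner ℂ v ((U g⁻¹ : H →L[ℂ] H) w) := by
  rw [← star_unitary, ContinuousLinearMap.star_eq_adjoint, ContinuousLinearMap.adjoint_inner_right]

theorem conjOp_eq_self_iff (g : G) (A : H →L[ℂ] H) :
    conjOp U g A = A ↔ Commute (U g : H →L[ℂ] H) A := by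
  constructor
  · intro h
    have := congrArg (· * (U g : H →L[ℂ] H)) h
    simp only [conjOp, mul_assoc, unitary_inv_mul, mul_one] at this
    exact this
  · intro h
    rw [conjOp, h.eq, mul_assoc, unitary_mul_inv, mul_one]

theorem orthogonal_mem (Z : Subrepresentation (toRep U)) (g : G) {v : H}
    (hv : v ∈ Z.toSubmoduleᗮ) : (U g : H →L[ℂ] H) v ∈ Z.toSubmoduleᗮ := by
  rw [Submodule.mem_orthogonal'] at hv ⊢
  intro z hz
  rw [inner_unitary_left]
  exact hv _ (Z.apply_mem_toSubmodule g⁻¹ hz)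

theorem commute_starProjection (Z : Subrepresentation (toRep U))
    [Z.toSubmodule.HasOrthogonalProjection] (g : G) :
    Commute (U g : H →L[ℂ] H) Z.toSubmodule.starProjection := by
  ext v
  refine (Submodule.eq_starProjection_of_mem_of_inner_eq_zero
    (Z.apply_mem_toSubmodule g (Submodule.starProjection_apply_mem _ v)) fun w hw => ?_).symm
  have h := orthogonal_mem U Z g (Submodule.sub_starProjection_mem_orthogonal v)
  rw [map_sub] at h
  exact Submodule.mem_orthogonal' _ _ |>.1 h w hw

/-- Unitarity makes the orthogonal projection onto an invariant subspace equivariant. -/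
theorem hasRetractions_toRep [FiniteDimensional ℂ H] : HasRetractions (toRep U) := fun Z => by
  refine ⟨codRestrictMap Z
    ((Z.toSubmodule.starProjection : H →ₗ[ℂ] H).intertwiningMap_of_isIntertwiningMap _ _
      fun g v => ?_) fun v => Submodule.starProjection_apply_mem _ v, fun z => Subtype.ext ?_⟩
  · exact (DFunLike.congr_fun (commute_starProjection U Z g).eq v).symm
  · exact Submodule.starProjection_eq_self_iff.2 z.2

theorem hasRetractions_restrictRep [FiniteDimensional ℂ H] (K : Subgroup G) :
    HasRetractions (restrictRep (toRep U) K) :=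
  hasRetractions_toRep (U.comp K.subtype)

omit [CompleteSpace H] in
theorem exists_pos_eigenvalue [FiniteDimensional ℂ H] {A : H →L[ℂ] H} (hA : 0 ≤ A) (h0 : A ≠ 0) :
    ∃ t : ℝ, 0 < t ∧ ∃ v : H, v ≠ 0 ∧ A v = (t : ℂ) • v := by
  have hp := (ContinuousLinearMap.nonneg_iff_isPositive A).1 hA
  have hpl := (ContinuousLinearMap.isPositive_toLinearMap_iff A).2 hp
  have hs : (A : H →ₗ[ℂ] H).IsSymmetric := hpl.isSymmetric
  by_contra! hc
  refine h0 ?_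
  have : (A : H →ₗ[ℂ] H) = 0 := by
    refine (hs.eigenvectorBasis rfl).toBasis.ext fun i => ?_
    have h1 := hs.apply_eigenvectorBasis rfl i
    have h2 := hpl.nonneg_eigenvalues rfl i
    rcases h2.eq_or_lt with h | h
    · simp [h1, ← h]
    · exact absurd h1 (hc _ h _ (((hs.eigenvectorBasis rfl).orthonormal).ne_zero i))
  exact ContinuousLinearMap.coe_injective this

/-- A positive `K`-invariant operator is dominated by a `G`-invariant one of controlled trace. -/
theorem exists_invariant_ge [FiniteDimensional ℂ H] {K : Subgroup G} {M : ℝ}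
    (hM : ∀ W : IrredSub (restrictRep (toRep U) K), ∃ Z : Subrepresentation (toRep U),
      W.1.toSubmodule ≤ Z.toSubmodule ∧
        (Module.finrank ℂ Z.toSubmodule : ℝ) ≤ M * Module.finrank ℂ W.1.toSubmodule)
    (A : H →L[ℂ] H) (hA : 0 ≤ A) (hK : ∀ g ∈ K, Commute (U g : H →L[ℂ] H) A) :
    ∃ B : H →L[ℂ] H, 0 ≤ B ∧ A ≤ B ∧ (∀ g, Commute (U g : H →L[ℂ] H) B) ∧
      (opTrace B).re ≤ M * (opTrace A).re := by
  induction hn : Module.finrank ℂ A.range using Nat.strong_induction_on generalizing A with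
  | _ n ih =>
    by_cases h0 : A = 0
    · subst h0
      exact ⟨0, le_rfl, le_rfl, fun _ => Commute.zero_right _, by simp [opTrace]⟩
    obtain ⟨t, ht, v, hv0, hv⟩ := exists_pos_eigenvalue hA h0
    -- The eigenspace is `K`-stable because `A` commutes with `K`; one irreducible piece `W` of it
    -- is removed at each stage of the induction on rank.
    let E : Subrepresentation (restrictRep (toRep U) K) :=
      ⟨Module.End.eigenspace (A : H →ₗ[ℂ] H) (t : ℂ), fun k w hw => by
        rw [Module.End.mem_eigenspace_iff] at hw ⊢
        have h1 : A ((U k : H →L[ℂ] H) w) = (U k : H →L[ℂ] H) (A w) :=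
          (DFunLike.congr_fun (hK k k.2).eq w).symm
        have h2 : A w = (t : ℂ) • w := hw
        change A ((U k : H →L[ℂ] H) w) = (t : ℂ) • (U k : H →L[ℂ] H) w
        rw [h1, h2, map_smul]⟩
    have hE : ∀ w, w ∈ E.toSubmodule ↔ A w = (t : ℂ) • w := fun w =>
      Module.End.mem_eigenspace_iff
    obtain ⟨W, hW⟩ := exists_irreducible_le E fun h => hv0 <| by
      have : v ∈ E.toSubmodule := (hE v).2 hv
      rw [h] at this
      exact (Submodule.mem_bot ℂ).1 this
    obtain ⟨Z, hWZ, hZ⟩ := hM W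
    let P : H →L[ℂ] H := W.1.toSubmodule.starProjection
    have hPs : IsStarProjection P := isStarProjection_starProjection
    have hAP : A * P = t • P := by
      ext w
      exact (hE _).1 (hW (Submodule.starProjection_apply_mem _ w))
    have hPA : P * A = t • P := by
      have := congrArg star hAP
      rw [star_mul, hPs.isSelfAdjoint.star_eq, (IsSelfAdjoint.of_nonneg hA).star_eq, star_smul,
        hPs.isSelfAdjoint.star_eq] at this
      simpa using this
    -- Subtracting `t • P` compresses `A` to the orthogonal complement of `W`, so positivity
    -- survives.
    have hA' : A - t • P = star (1 - P) * A * (1 - P) := by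
      rw [star_sub, star_one, hPs.isSelfAdjoint.star_eq, sub_mul, sub_mul, one_mul, hPA, mul_sub,
        mul_one, hAP, mul_sub, mul_one, smul_mul_assoc, hPs.isIdempotentElem.eq]
      abel
    have hA'0 : 0 ≤ A - t • P := hA' ▸ star_left_conjugate_nonneg hA _
    -- The rank drops because the kernel gains `W`, on which `A` acts as `t ≠ 0`.
    have hlt : Module.finrank ℂ (A - t • P).range < n := by
      have h1 := LinearMap.finrank_range_add_finrank_ker (A : H →ₗ[ℂ] H)
      have h2 := LinearMap.finrank_range_add_finrank_ker ((A - t • P : H →L[ℂ] H) : H →ₗ[ℂ] H)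
      have h3 : (A : H →ₗ[ℂ] H).ker < ((A - t • P : H →L[ℂ] H) : H →ₗ[ℂ] H).ker := by
        have hPA' : ∀ x, P (A x) = t • P x := fun x => DFunLike.congr_fun hPA x
        refine lt_of_le_of_ne (fun x hx => ?_) fun heq => ?_
        · have hx' : A x = 0 := hx
          change A x - t • P x = 0
          rw [← hPA', hx', map_zero, sub_zero]
        · have := W.2
          obtain ⟨Y, hY⟩ := exists_ne (⊥ : Subrepresentation W.1.toRepresentation)
          obtain ⟨y, -, hy0⟩ := Submodule.exists_mem_ne_zero_of_ne_bot
            fun h => hY (Subrepresentation.toSubmodule_injective h)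
          have hAy : A y = (t : ℂ) • (y : H) := (hE _).1 (hW y.2)
          have hPy : P y = y := Submodule.starProjection_eq_self_iff.2 y.2
          have hy : (y : H) ∈ (A : H →ₗ[ℂ] H).ker := by
            rw [heq]
            change A y - t • P y = 0
            rw [hAy, hPy, Complex.coe_smul, sub_self]
          have h5 : A y = 0 := hy
          rw [hAy] at h5
          rcases smul_eq_zero.1 h5 with h | h
          · exact ht.ne' (Complex.ofReal_eq_zero.1 h)
          · exact hy0 (Subtype.ext h)
      have h4 := Submodule.finrank_lt_finrank_of_lt h3
      change Module.finrank ℂ (A : H →ₗ[ℂ] H).range = n at hn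
      change Module.finrank ℂ ((A - t • P : H →L[ℂ] H) : H →ₗ[ℂ] H).range < n
      omega
    have hPK : ∀ g ∈ K, Commute (U g : H →L[ℂ] H) P := fun g hg =>
      commute_starProjection (U.comp K.subtype) W.1 ⟨g, hg⟩
    obtain ⟨B, hB0, hAB, hBG, hBt⟩ := ih _ hlt (A - t • P) hA'0
      (fun g hg => (hK g hg).sub_right ((hPK g hg).smul_right t)) rfl
    let Q : H →L[ℂ] H := Z.toSubmodule.starProjection
    have hQ0 : 0 ≤ Q := (isStarProjection_starProjection (U := Z.toSubmodule)).nonneg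
    have hPQ : P ≤ Q := Submodule.starProjection_le_starProjection_iff.2 hWZ
    refine ⟨B + t • Q, add_nonneg hB0 (smul_nonneg ht.le hQ0), ?_, fun g =>
      (hBG g).add_right ((commute_starProjection U Z g).smul_right t), ?_⟩
    · have := add_le_add hAB (smul_le_smul_of_nonneg_left hPQ ht.le)
      simpa using this
    · simp only [← expVal_one_left, expVal_add_right, expVal_sub_right, expVal_smul_right] at hBt ⊢
      have h1 : expVal 1 P = Module.finrank ℂ W.1.toSubmodule := by
        rw [expVal_one_left, opTrace_starProjection, Complex.natCast_re]
      have h2 : expVal 1 Q = Module.finrank ℂ Z.toSubmodule := by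
        rw [expVal_one_left, opTrace_starProjection, Complex.natCast_re]
      rw [h1] at hBt
      rw [h2]
      nlinarith [mul_le_mul_of_nonneg_left hZ ht.le]

end Unitary

/-! ### Inverse square roots on the support -/

section FiniteSpectrum

theorem finite_spectrum_real {A : Type*} [Ring A] [Algebra ℝ A] [FiniteDimensional ℝ A] (a : A) :
    (spectrum ℝ a).Finite := by
  cases subsingleton_or_nontrivial A
  · simp [spectrum.of_subsingleton]
  refine ((minpoly ℝ a).rootSet_finite ℝ).subset fun r hr => ?_
  rw [Polynomial.mem_rootSet]
  refine ⟨minpoly.ne_zero (Algebra.IsIntegral.isIntegral a), ?_⟩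
  have := spectrum.subset_polynomial_aeval a (minpoly ℝ a) ⟨r, hr, rfl⟩
  rw [minpoly.aeval, spectrum.zero_eq, Set.mem_singleton_iff] at this
  simpa using this

variable {H : Type*} [NormedAddCommGroup H] [InnerProductSpace ℂ H] [CompleteSpace H]
  [FiniteDimensional ℂ H]

/-- A positive operator can be normalised to a projection by an operator in its bicommutant. -/
theorem exists_conj_isStarProjection {S : H →L[ℂ] H} (hS : 0 ≤ S) :
    ∃ R : H →L[ℂ] H, IsSelfAdjoint R ∧ (∀ B, Commute S B → Commute R B) ∧
      IsStarProjection (R * S * R) ∧ S * (R * S * R) = S := by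
  have : FiniteDimensional ℝ (H →L[ℂ] H) := FiniteDimensional.complexToReal _
  have hc (f : ℝ → ℝ) : ContinuousOn f (spectrum ℝ S) := (finite_spectrum_real S).continuousOn f
  have hsa : IsSelfAdjoint S := .of_nonneg hS
  -- As `(√0)⁻¹ = 0`, this is the inverse square root on the support and zero on the kernel. Its
  -- discontinuity at `0` is harmless on a finite spectrum.
  let f : ℝ → ℝ := fun x => (√x)⁻¹
  have hP : cfc f S * S * cfc f S = cfc (fun x => f x * x * f x) S := by
    rw [cfc_mul _ _ S (hc _) (hc _), cfc_mul _ _ S (hc _) (hc _), cfc_id' ℝ S]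
  have hx {x : ℝ} (hx : x ∈ spectrum ℝ S) : f x * x * f x = if x = 0 then 0 else 1 := by
    have h0 : 0 ≤ x := spectrum_nonneg_of_nonneg hS hx
    split_ifs with h
    · simp [h]
    · have : √x ≠ 0 := by simpa [Real.sqrt_eq_zero h0] using h
      have h2 := Real.mul_self_sqrt h0
      simp only [f]
      field_simp
      rw [sq, h2]
  refine ⟨cfc f S, cfc_predicate f S, fun B hB => hB.cfc_real f, ⟨?_, ?_⟩, ?_⟩
  · rw [hP, IsIdempotentElem, ← cfc_mul _ _ S (hc _) (hc _)]
    refine cfc_congr fun x h => ?_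
    simp only [hx h]
    split_ifs <;> simp
  · rw [hP]
    exact cfc_predicate _ S
  · rw [hP]
    conv_lhs => enter [1]; rw [← cfc_id' ℝ S]
    conv_rhs => rw [← cfc_id' ℝ S]
    rw [← cfc_mul _ _ S (hc _) (hc _)]
    refine cfc_congr fun x h => ?_
    simp only [hx h]
    split_ifs with h <;> simp [h]

end FiniteSpectrum

/-! ### Averaging operators over the group -/

section Twirl

variable {G : Type*} [Group G] [MeasurableSpace G] {H : Type*} [NormedAddCommGroup H]
  [InnerProductSpace ℂ H] [CompleteSpace H] (U : G →* unitary (H →L[ℂ] H)) (ν : Measure G)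

/-- The average `∫ g⁻¹ F(g) g dg`. -/
def twirl (F : G → H →L[ℂ] H) : H →L[ℂ] H :=
  ∫ g, (U g⁻¹ : H →L[ℂ] H) * F g * (U g : H →L[ℂ] H) ∂ν

variable {U}

omit [MeasurableSpace G] in
theorem conj_nonneg {A : H →L[ℂ] H} (hA : 0 ≤ A) (g : G) :
    0 ≤ (U g⁻¹ : H →L[ℂ] H) * A * (U g : H →L[ℂ] H) := by
  rw [← star_unitary]
  exact star_left_conjugate_nonneg hA _

omit [MeasurableSpace G] in
theorem conj_le_one {A : H →L[ℂ] H} (hA : A ≤ 1) (g : G) :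
    (U g⁻¹ : H →L[ℂ] H) * A * (U g : H →L[ℂ] H) ≤ 1 := by
  have := conj_nonneg (U := U) (sub_nonneg.2 hA) g
  rw [mul_sub, sub_mul, mul_one, unitary_inv_mul] at this
  exact sub_nonneg.1 this

variable {ν} in
theorem twirl_nonneg {F : G → H →L[ℂ] H} (hF : ∀ g, 0 ≤ F g) : 0 ≤ twirl U ν F :=
  integral_nonneg fun g => conj_nonneg (hF g) g

variable [FiniteDimensional ℂ H]

/-- The expectation value in a fixed operator, as a continuous linear functional. -/
def expValL (A : H →L[ℂ] H) : (H →L[ℂ] H) →L[ℝ] ℝ :=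
  have : FiniteDimensional ℝ (H →L[ℂ] H) := FiniteDimensional.complexToReal _
  LinearMap.toContinuousLinearMap
    { toFun := expVal A
      map_add' := expVal_add_right A
      map_smul' := fun r B => expVal_smul_right A B r }

omit [CompleteSpace H] in
@[simp]
theorem expValL_apply (A E : H →L[ℂ] H) : expValL A E = expVal A E := rfl

omit [MeasurableSpace G] [FiniteDimensional ℂ H] in
theorem expVal_conj (A B : H →L[ℂ] H) (g : G) :
    expVal A ((U g⁻¹ : H →L[ℂ] H) * B * (U g : H →L[ℂ] H)) = expVal (conjOp U g A) B := by
  rw [expVal_eq, ← mul_assoc, opTrace_mul_comm, expVal_eq, conjOp]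
  simp only [mul_assoc]

section Integrable

variable {ν}

theorem expVal_twirl {F : G → H →L[ℂ] H}
    (hF : Integrable (fun g => (U g⁻¹ : H →L[ℂ] H) * F g * (U g : H →L[ℂ] H)) ν)
    (A : H →L[ℂ] H) : expVal A (twirl U ν F) = ∫ g, expVal (conjOp U g A) (F g) ∂ν := by
  rw [← expValL_apply, twirl, ← ContinuousLinearMap.integral_comp_comm _ hF]
  simp only [expValL_apply, expVal_conj]

theorem expVal_twirl_const [IsProbabilityMeasure ν] {B : H →L[ℂ] H}
    (hB : Integrable (fun g => (U g⁻¹ : H →L[ℂ] H) * B * (U g : H →L[ℂ] H)) ν)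
    {A : H →L[ℂ] H} (hA : ∀ g, Commute (U g : H →L[ℂ] H) A) :
    expVal A (twirl U ν fun _ => B) = expVal A B := by
  rw [expVal_twirl hB]
  simp [fun g => (conjOp_eq_self_iff U g A).2 (hA g)]

omit [FiniteDimensional ℂ H] in
theorem twirl_le_one [IsProbabilityMeasure ν] {F : G → H →L[ℂ] H}
    (hF : Integrable (fun g => (U g⁻¹ : H →L[ℂ] H) * F g * (U g : H →L[ℂ] H)) ν)
    (h1 : ∀ g, F g ≤ 1) : twirl U ν F ≤ 1 := by
  have := integral_mono (μ := ν) hF (integrable_const 1) fun g => conj_le_one (h1 g) g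
  simpa [twirl] using this

omit [FiniteDimensional ℂ H] in
theorem mul_twirl_mul {B : H →L[ℂ] H}
    (hB : Integrable (fun g => (U g⁻¹ : H →L[ℂ] H) * B * (U g : H →L[ℂ] H)) ν)
    {R : H →L[ℂ] H} (hR : ∀ g, Commute (U g : H →L[ℂ] H) R) :
    R * (twirl U ν fun _ => B) * R = twirl U ν fun _ => R * B * R := by
  rw [twirl, ← integral_const_mul_of_integrable hB,
    ← integral_mul_const_of_integrable (hB.const_mul R), twirl]
  refine integral_congr_ae (.of_forall fun g => ?_)
  simp only [mul_assoc]
  rw [← (hR g).eq]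
  simp only [← mul_assoc]
  rw [(hR g⁻¹).eq]

omit [FiniteDimensional ℂ H] in
theorem commute_twirl [MeasurableMul G] [ν.IsMulRightInvariant] {B : H →L[ℂ] H}
    (hB : Integrable (fun g => (U g⁻¹ : H →L[ℂ] H) * B * (U g : H →L[ℂ] H)) ν) (h : G) :
    Commute (U h : H →L[ℂ] H) (twirl U ν fun _ => B) := by
  rw [← conjOp_eq_self_iff, conjOp, twirl, ← integral_const_mul_of_integrable hB,
    ← integral_mul_const_of_integrable (hB.const_mul _),
    ← integral_mul_right_eq_self _ h]
  refine integral_congr_ae (.of_forall fun g => ?_)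
  simp only [mul_inv_rev, map_mul, Submonoid.coe_mul, mul_assoc]
  rw [unitary_mul_inv, mul_one, ← mul_assoc (U h : H →L[ℂ] H), unitary_mul_inv, one_mul]

end Integrable

section Continuous

variable [TopologicalSpace G]

omit [MeasurableSpace G] in
theorem continuous_unitary (hU : ∀ v : H, Continuous fun g => (U g : H →L[ℂ] H) v) :
    Continuous fun g => (U g : H →L[ℂ] H) :=
  continuous_clm_apply.2 hU

omit [MeasurableSpace G] in
theorem continuous_unitary_inv (hU : ∀ v : H, Continuous fun g => (U g : H →L[ℂ] H) v) :
    Continuous fun g => (U g⁻¹ : H →L[ℂ] H) := by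
  simp only [← star_unitary]
  exact (continuous_unitary hU).star

omit [MeasurableSpace G] in
theorem continuous_conj (hU : ∀ v : H, Continuous fun g => (U g : H →L[ℂ] H) v) (B : H →L[ℂ] H) :
    Continuous fun g => (U g⁻¹ : H →L[ℂ] H) * B * (U g : H →L[ℂ] H) :=
  ((continuous_unitary_inv hU).mul continuous_const).mul (continuous_unitary hU)

variable {ν} [OpensMeasurableSpace G]

theorem integrable_conj_const [CompactSpace G] [IsFiniteMeasure ν]
    (hU : ∀ v : H, Continuous fun g => (U g : H →L[ℂ] H) v) (B : H →L[ℂ] H) :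
    Integrable (fun g => (U g⁻¹ : H →L[ℂ] H) * B * (U g : H →L[ℂ] H)) ν :=
  (continuous_conj hU B).integrable_of_hasCompactSupport (HasCompactSupport.of_compactSpace _)

theorem integrable_conj [SecondCountableTopology G] [IsFiniteMeasure ν]
    (hU : ∀ v : H, Continuous fun g => (U g : H →L[ℂ] H) v) {F : G → H →L[ℂ] H}
    (hF : AEStronglyMeasurable F ν) (h0 : ∀ g, 0 ≤ F g) (h1 : ∀ g, F g ≤ 1) :
    Integrable (fun g => (U g⁻¹ : H →L[ℂ] H) * F g * (U g : H →L[ℂ] H)) ν := by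
  refine .of_bound (C := 1) (((continuous_unitary_inv hU).aestronglyMeasurable.mul hF).mul
    (continuous_unitary hU).aestronglyMeasurable) (.of_forall fun g => ?_)
  exact (CStarAlgebra.norm_le_one_iff_of_nonneg _ (conj_nonneg (h0 g) g)).2 (conj_le_one (h1 g) g)

end Continuous

end Twirl

/-! ### The optimal `K`-invariant state -/

section UpperBound

variable {G : Type*} [Group G] {H : Type*} [NormedAddCommGroup H]
  [InnerProductSpace ℂ H] [CompleteSpace H] [FiniteDimensional ℂ H]
  {U : G →* unitary (H →L[ℂ] H)} {K : Subgroup G}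

open ContinuousLinearMap (adjoint)

/-- Schur's lemma. -/
theorem exists_eq_smul_of_commute {V : Type*} [AddCommGroup V] [Module ℂ V] [FiniteDimensional ℂ V]
    {τ : Representation ℂ G V} [τ.IsIrreducible] (B : V →ₗ[ℂ] V)
    (hB : ∀ g v, B (τ g v) = τ g (B v)) : ∃ c : ℂ, ∀ v, B v = c • v := by
  obtain ⟨c, hc⟩ := (IsIrreducible.algebraMap_intertwiningMap_bijective_of_isAlgClosed
    (ρ := τ)).2 (B.intertwiningMap_of_isIntertwiningMap τ τ hB)
  exact ⟨c, fun v => (DFunLike.congr_fun hc v).symm⟩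

/-- An intertwining map as a continuous linear map. -/
def toCLM {m : Isotype (restrictRep (toRep U) K)}
    (T : IntertwiningMap m.rep (restrictRep (toRep U) K)) : m.space →L[ℂ] H :=
  LinearMap.toContinuousLinearMap T.toLinearMap

variable {m : Isotype (restrictRep (toRep U) K)}
  (T : IntertwiningMap m.rep (restrictRep (toRep U) K))

theorem toCLM_rep (k : K) (v : m.space) :
    toCLM T (m.rep k v) = (U k : H →L[ℂ] H) (toCLM T v) :=
  T.isIntertwining _ _ k v

theorem adjoint_toCLM_unitary (k : K) (v : H) :
    adjoint (toCLM T) ((U k : H →L[ℂ] H) v) = m.rep k (adjoint (toCLM T) v) := by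
  refine ext_inner_right ℂ fun w => ?_
  have h : inner ℂ (m.rep k (adjoint (toCLM T) v)) w =
      inner ℂ (adjoint (toCLM T) v) (m.rep k⁻¹ w) :=
    inner_unitary_left U (k : G) _ _
  rw [h, ContinuousLinearMap.adjoint_inner_left, ContinuousLinearMap.adjoint_inner_left, toCLM_rep,
    inner_unitary_left]
  rfl

theorem commute_comp_adjoint {k : G} (hk : k ∈ K) :
    Commute (U k : H →L[ℂ] H) (toCLM T ∘L adjoint (toCLM T)) := by
  ext v
  have h1 := adjoint_toCLM_unitary T ⟨k, hk⟩ v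
  have h2 := toCLM_rep T ⟨k, hk⟩ (adjoint (toCLM T) v)
  change (U k : H →L[ℂ] H) (toCLM T (adjoint (toCLM T) v)) =
    toCLM T (adjoint (toCLM T) ((U k : H →L[ℂ] H) v))
  rw [h1, h2]

variable [TopologicalSpace G] [CompactSpace G] [MeasurableSpace G] [BorelSpace G]
  [ContinuousMul G] {ν : Measure G} [IsProbabilityMeasure ν] [ν.IsMulRightInvariant]
  [ν.IsOpenPosMeasure]

omit [FiniteDimensional ℂ H] in
theorem comp_adjoint_nonneg {V : Type*} [NormedAddCommGroup V] [InnerProductSpace ℂ V]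
    [CompleteSpace V] (T : V →L[ℂ] H) : 0 ≤ T ∘L adjoint T := by
  rw [ContinuousLinearMap.nonneg_iff_isPositive]
  exact ContinuousLinearMap.isPositive_self_comp_adjoint T

omit [ContinuousMul G] [ν.IsMulRightInvariant] in
/-- The support of the average of `T T†` contains the range of `T`. -/
theorem adjoint_apply_eq_zero_of_twirl (hU : ∀ v : H, Continuous fun g => (U g : H →L[ℂ] H) v)
    {V : Type*} [NormedAddCommGroup V] [InnerProductSpace ℂ V] [CompleteSpace V] (T : V →L[ℂ] H)
    {v : H} (hv : (twirl U ν fun _ => T ∘L adjoint T) v = 0) : adjoint T v = 0 := by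
  let L : (H →L[ℂ] H) →L[ℝ] ℝ := Complex.reCLM ∘L ((innerSL ℂ v ∘L
    ContinuousLinearMap.apply ℂ H v).restrictScalars ℝ)
  have hL : ∀ A, L A = (inner ℂ v (A v)).re := fun A => rfl
  have h1 : L (twirl U ν fun _ => T ∘L adjoint T) = 0 := by rw [hL, hv]; simp
  rw [twirl, ← L.integral_comp_comm (integrable_conj_const hU _)] at h1
  -- The integrand is a continuous nonnegative function of `g` with integral zero; full support of
  -- `ν` forces it to vanish everywhere, in particular at `g = 1`.
  have h2 (g : G) : L ((U g⁻¹ : H →L[ℂ] H) * (T ∘L adjoint T) * (U g : H →L[ℂ] H)) =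
      ‖adjoint T ((U g : H →L[ℂ] H) v)‖ ^ 2 := by
    rw [hL]
    change (inner ℂ v ((U g⁻¹ : H →L[ℂ] H) (T (adjoint T ((U g : H →L[ℂ] H) v))))).re = _
    rw [← inner_unitary_left, ← ContinuousLinearMap.adjoint_inner_left,
      inner_self_eq_norm_sq_to_K]
    norm_cast
  simp only [h2] at h1
  have hc : Continuous fun g => ‖adjoint T ((U g : H →L[ℂ] H) v)‖ ^ 2 :=
    (((adjoint T).continuous.comp (hU v)).norm).pow 2
  rw [integral_eq_zero_iff_of_nonneg (fun g => by positivity)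
    (hc.integrable_of_hasCompactSupport (HasCompactSupport.of_compactSpace _))] at h1
  have := congrFun ((hc.ae_eq_iff_eq ν continuous_zero).1 h1) 1
  simpa using this

omit [FiniteDimensional ℂ H] in
/-- A multiple of a projection yields an optimal test for its normalisation. -/
theorem beta_smul_le {A σ : H →L[ℂ] H} (hA : 0 ≤ A) {r d : ℝ} (hr0 : 0 < r) (hd0 : 0 < d)
    (hAA : A * A = r • A) (htrA : (opTrace A).re = d) (hσ : expVal σ A ≤ 1) {α : ℝ≥0∞}
    (hα : α ≤ 1) : beta α (d⁻¹ • A) σ ≤ α / ENNReal.ofReal r := by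
  have hQ : IsStarProjection (r⁻¹ • A) := by
    refine ⟨?_, ?_⟩
    · rw [IsIdempotentElem, smul_mul_smul_comm, hAA, smul_smul, mul_assoc,
        inv_mul_cancel₀ hr0.ne', mul_one]
    · exact (IsSelfAdjoint.all r⁻¹).smul (IsSelfAdjoint.of_nonneg hA)
  have hQ1 : r⁻¹ • A ≤ 1 := sub_nonneg.1 hQ.one_sub.nonneg
  have hQ0 : 0 ≤ r⁻¹ • A := hQ.nonneg
  have hαt : α ≠ ⊤ := ne_top_of_le_ne_top ENNReal.one_ne_top hα
  have ha0 : 0 ≤ α.toReal := ENNReal.toReal_nonneg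
  have ha1 : α.toReal ≤ 1 := ENNReal.toReal_mono ENNReal.one_ne_top hα
  -- The test is `α` times the projection `r⁻¹ A`; the assumption `α ≤ 1` keeps it an effect.
  have hE1 : α.toReal • r⁻¹ • A ≤ 1 :=
    (smul_le_smul_of_nonneg_right ha1 hQ0).trans (by rwa [one_smul])
  have hρE : expVal (d⁻¹ • A) (α.toReal • r⁻¹ • A) = α.toReal := by
    rw [expVal_smul_right, expVal_smul_right, expVal_smul_left, expVal_eq, hAA, ← expVal_one_left,
      expVal_smul_right, expVal_one_left, htrA]
    field_simp
  have hσE : expVal σ (α.toReal • r⁻¹ • A) ≤ α.toReal * r⁻¹ := by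
    rw [expVal_smul_right, expVal_smul_right]
    have h2 : 0 ≤ α.toReal * r⁻¹ := by positivity
    nlinarith
  refine (iInf_le_of_le (α.toReal • r⁻¹ • A) <| iInf_le_of_le (smul_nonneg ha0 hQ0) <|
    iInf_le_of_le hE1 <| iInf_le_of_le (by rw [hρE, ENNReal.ofReal_toReal hαt]) le_rfl).trans ?_
  refine (ENNReal.ofReal_le_ofReal hσE).trans ?_
  rw [ENNReal.ofReal_mul ha0, ENNReal.ofReal_toReal hαt, div_eq_mul_inv,
    ENNReal.ofReal_inv_of_pos hr0]

omit [ContinuousMul G] in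
-- The normalisation by `R` makes the average of `A` a projection, so a `G`-invariant `σ` sees `A`
-- as an effect. The state depends neither on `σ` nor on `α`.
theorem exists_state_beta_le [MeasurableMul G]
    (hU : ∀ v : H, Continuous fun g => (U g : H →L[ℂ] H) v) (ν : Measure G)
    [IsProbabilityMeasure ν] [ν.IsMulRightInvariant] [ν.IsOpenPosMeasure]
    (m : Isotype (restrictRep (toRep U) K)) :
    ∃ ρ ∈ invariantStates U K, ∀ σ ∈ invariantStates U (⊤ : Subgroup G), ∀ α ≤ 1,
      beta α ρ σ ≤ α / branchingSum (toRep U) K m := by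
  have hπ := hasRetractions_toRep U
  obtain ⟨T, hT⟩ := exists_finrank_genSub_eq_dim_mul hπ m
  let A₀ : H →L[ℂ] H := toCLM T ∘L adjoint (toCLM T)
  have hA₀ : 0 ≤ A₀ := comp_adjoint_nonneg _
  let S := twirl U ν fun _ => A₀
  have hS : 0 ≤ S := twirl_nonneg fun _ => hA₀
  have hSU : ∀ g, Commute (U g : H →L[ℂ] H) S := commute_twirl (integrable_conj_const hU _)
  obtain ⟨R, hR, hRc, hP, hSP⟩ := exists_conj_isStarProjection hS
  have hRU : ∀ g, Commute (U g : H →L[ℂ] H) R := fun g => (hRc _ (hSU g).symm).symm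
  let P := R * S * R
  let A := R * A₀ * R
  have hPA : P = twirl U ν fun _ => A := mul_twirl_mul (integrable_conj_const hU _) hRU
  have hA : 0 ≤ A := by
    have := star_left_conjugate_nonneg hA₀ R
    rwa [hR.star_eq] at this
  have hAK : ∀ k ∈ K, Commute (U k : H →L[ℂ] H) A := fun k hk =>
    ((hRU k).mul_right (commute_comp_adjoint T hk)).mul_right (hRU k)
  have hexp (σ : H →L[ℂ] H) (hσ : ∀ g, Commute (U g : H →L[ℂ] H) σ) :
      expVal σ A = expVal σ P := by
    rw [hPA, expVal_twirl_const (integrable_conj_const hU _) hσ]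
  -- the range of `P` contains the subrepresentation generated by `T`
  have hPT : ∀ w, P (T w) = T w := by
    have h1 : adjoint (toCLM T) ∘L (1 - P) = 0 := by
      ext v
      refine congrArg _ (adjoint_apply_eq_zero_of_twirl (ν := ν) hU (toCLM T) (v := (1 - P) v) ?_)
      have : S * (1 - P) = 0 := by rw [mul_sub, mul_one, hSP, sub_self]
      exact DFunLike.congr_fun this v
    have h2 := congrArg adjoint h1
    rw [ContinuousLinearMap.adjoint_comp, ContinuousLinearMap.adjoint_adjoint, map_zero] at h2
    intro w
    have h3 : adjoint (1 - P) = 1 - P := by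
      rw [← ContinuousLinearMap.star_eq_adjoint]
      exact (IsSelfAdjoint.one _).sub hP.isSelfAdjoint
    rw [h3] at h2
    have h4 : T w - P (T w) = 0 := DFunLike.congr_fun h2 w
    exact (sub_eq_zero.1 h4).symm
  let d' := Module.finrank ℂ P.range
  have hd' : (m.dim : ℝ≥0∞) * branchingSum (toRep U) K m ≤ d' := by
    rw [← hT]
    let Z : Subrepresentation (toRep U) := ⟨P.range, by
      rintro g _ ⟨v, rfl⟩
      have : Commute (U g : H →L[ℂ] H) P := ((hRU g).mul_right (hSU g)).mul_right (hRU g)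
      exact ⟨(U g : H →L[ℂ] H) v, (DFunLike.congr_fun this.eq v).symm⟩⟩
    have : (genSub T).toSubmodule ≤ Z.toSubmodule := genSub_le fun w => ⟨T w, hPT w⟩
    exact_mod_cast Submodule.finrank_mono this
  have hd0 : 0 < d' := by
    have : (0 : ℝ≥0∞) < d' := lt_of_lt_of_le (ENNReal.mul_pos
      (by simpa using m.dim_pos.ne') (branchingSum_pos hπ m).ne') hd'
    exact_mod_cast this
  have htrA : (opTrace A).re = d' := by
    rw [← expVal_one_left, hexp 1 fun g => Commute.one_right _, expVal_one_left,
      opTrace_of_isIdempotentElem hP.isIdempotentElem, Complex.natCast_re]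
  have htrA' : opTrace A = d' := Complex.ext (by simpa using htrA)
    (by simpa using opTrace_im_eq_zero hA)
  -- `A` is a multiple of a projection
  obtain ⟨c, hc⟩ := exists_eq_smul_of_commute (τ := m.rep)
    ((adjoint (toCLM T) ∘L (R * R) ∘L toCLM T : m.space →L[ℂ] m.space) : m.space →ₗ[ℂ] m.space)
    fun k v => by
      change adjoint (toCLM T) ((R * R) (toCLM T (m.rep k v))) =
        m.rep k (adjoint (toCLM T) ((R * R) (toCLM T v)))
      rw [toCLM_rep, ← adjoint_toCLM_unitary]
      congr 1
      exact (DFunLike.congr_fun ((hRU k).mul_right (hRU k)).eq (toCLM T v)).symm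
  -- The inner factor `T† R² T` of `A²` is `K`-equivariant on the irreducible `V_m`, hence the
  -- scalar `c`.
  have hAA : A * A = c • A := by
    ext v
    have := hc (adjoint (toCLM T) (R v))
    change R (toCLM T (adjoint (toCLM T) (R (R (toCLM T (adjoint (toCLM T) (R v))))))) =
      c • R (toCLM T (adjoint (toCLM T) (R v)))
    change adjoint (toCLM T) (R (R (toCLM T (adjoint (toCLM T) (R v))))) = _ at this
    rw [this, map_smul, map_smul]
  -- The trace of `(R T)(T† R) = A` is `rank P`; in the opposite order the product is `c` times the
  -- identity of `V_m`.
  have hcd : (d' : ℂ) = c * m.dim := by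
    have h1 := LinearMap.trace_comp_comm' ((R ∘L toCLM T : m.space →L[ℂ] H) : m.space →ₗ[ℂ] H)
      ((adjoint (toCLM T) ∘L R : H →L[ℂ] m.space) : H →ₗ[ℂ] m.space)
    have h2 : ((adjoint (toCLM T) ∘L R : H →L[ℂ] m.space) : H →ₗ[ℂ] m.space) ∘ₗ
        ((R ∘L toCLM T : m.space →L[ℂ] H) : m.space →ₗ[ℂ] H) = c • LinearMap.id :=
      LinearMap.ext hc
    rw [h2, map_smul, LinearMap.trace_id] at h1
    exact htrA'.symm.trans h1.symm
  have hm0 : (0 : ℝ) < m.dim := Nat.cast_pos.2 m.dim_pos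
  have hd0' : (0 : ℝ) < d' := Nat.cast_pos.2 hd0
  let r : ℝ := d' / m.dim
  have hr0 : 0 < r := div_pos hd0' hm0
  have hcr : c = r := by
    have : (m.dim : ℂ) ≠ 0 := by exact_mod_cast hm0.ne'
    rw [Complex.ofReal_div, Complex.ofReal_natCast, Complex.ofReal_natCast, hcd,
      mul_div_cancel_right₀ _ this]
  have hAA' : A * A = r • A := by rw [hAA, hcr]; ext v; simp
  have hρ : IsState ((d' : ℝ)⁻¹ • A) := by
    refine isState_iff.2 ⟨smul_nonneg (by positivity) hA, ?_⟩
    rw [← expVal_one_left, expVal_smul_right, expVal_one_left, htrA, inv_mul_cancel₀ hd0'.ne']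
  refine ⟨(d' : ℝ)⁻¹ • A, ⟨hρ, fun k hk => ?_⟩, fun σ hσ α hα => ?_⟩
  · exact (conjOp_eq_self_iff U k _).2 ((hAK k hk).smul_right _)
  have hσA : expVal σ A ≤ 1 := by
    rw [hexp σ fun g => (conjOp_eq_self_iff U g σ).1 (hσ.2 g trivial)]
    exact hσ.1.expVal_le_one (sub_nonneg.1 hP.one_sub.nonneg)
  refine (beta_smul_le hA hr0 hd0' hAA' htrA hσA hα).trans ?_
  gcongr
  rw [ENNReal.ofReal_div_of_pos hm0, ENNReal.ofReal_natCast, ENNReal.ofReal_natCast,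
    ENNReal.le_div_iff_mul_le (.inl (by simpa using m.dim_pos.ne')) (.inl (by simp)), mul_comm]
  exact hd'

end UpperBound

/-! ### Evaluation of the infimum -/

section Evaluation

variable {G : Type*} [Group G] {H : Type*} [NormedAddCommGroup H]
  [InnerProductSpace ℂ H] [CompleteSpace H] [FiniteDimensional ℂ H]
  (U : G →* unitary (H →L[ℂ] H)) (K : Subgroup G)

theorem exists_branchingSum_max [Nontrivial H] :
    ∃ m₀, ∀ m, branchingSum (toRep U) K m ≤ branchingSum (toRep U) K m₀ := by
  have := finite_isotype (hasRetractions_restrictRep U K)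
  have := nonempty_isotype (restrictRep (toRep U) K)
  exact Finite.exists_max _

theorem iSup_branchingSum_ne_top [Nontrivial H] : ⨆ m, branchingSum (toRep U) K m ≠ ⊤ := by
  obtain ⟨m₀, hm₀⟩ := exists_branchingSum_max U K
  exact ne_top_of_le_ne_top (branchingSum_ne_top (hasRetractions_toRep U) m₀) (iSup_le hm₀)

variable {U K}

/-- Normalising the `G`-invariant majorant `B` of `ρ` gives `σ` with `tr(ρE) ≤ tr(BE) ≤ M tr(σE)`
for every effect `E`. -/
theorem exists_state_le_beta [Nontrivial H] {ρ : H →L[ℂ] H} (hρ : ρ ∈ invariantStates U K) :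
    ∃ σ ∈ invariantStates U (⊤ : Subgroup G), ∀ α,
      α / (⨆ m, branchingSum (toRep U) K m) ≤ beta α ρ σ := by
  set M := ⨆ m, branchingSum (toRep U) K m
  have hM : M ≠ ⊤ := iSup_branchingSum_ne_top U K
  obtain ⟨B, hB0, hB, hBU, hBt⟩ := exists_invariant_ge U (K := K) (M := M.toReal) (fun W => by
      obtain ⟨Z, hWZ, hZ⟩ := exists_subrepresentation_ge (hasRetractions_toRep U) W
      refine ⟨Z, hWZ, ?_⟩
      have h1 : (Module.finrank ℂ Z.toSubmodule : ℝ≥0∞) ≤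
          M * Module.finrank ℂ W.1.toSubmodule :=
        (hZ.trans (mul_le_mul_right (le_iSup _ _) _)).trans_eq (mul_comm _ _)
      simpa using ENNReal.toReal_mono (ENNReal.mul_ne_top hM (by simp)) h1)
    ρ hρ.1.nonneg fun g hg => (conjOp_eq_self_iff U g ρ).1 (hρ.2 g hg)
  have hρt : (opTrace ρ).re = 1 := (isState_iff.1 hρ.1).2
  have hb1 : 1 ≤ (opTrace B).re := by
    rw [← hρt, ← expVal_one_left, ← expVal_one_left]
    exact expVal_mono_right zero_le_one hB
  have hb0 : 0 < (opTrace B).re := by linarith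
  rw [hρt, mul_one] at hBt
  refine ⟨(opTrace B).re⁻¹ • B, ⟨isState_iff.2 ⟨smul_nonneg (by positivity) hB0, ?_⟩,
    fun g _ => (conjOp_eq_self_iff U g _).2 ((hBU g).smul_right _)⟩, fun α => ?_⟩
  · rw [← expVal_one_left, expVal_smul_right, expVal_one_left, inv_mul_cancel₀ hb0.ne']
  refine le_iInf fun E => le_iInf fun hE0 => le_iInf fun _ => le_iInf fun hα =>
    ENNReal.div_le_of_le_mul' (hα.trans ?_)
  rw [← ENNReal.ofReal_toReal hM, ← ENNReal.ofReal_mul ENNReal.toReal_nonneg]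
  refine ENNReal.ofReal_le_ofReal ((expVal_mono_left hE0 hB).trans ?_)
  have h := expVal_nonneg hB0 hE0
  rw [expVal_smul_left, ← mul_assoc]
  refine le_mul_of_one_le_left h ?_
  rw [← div_eq_mul_inv, one_le_div hb0]
  exact hBt

theorem infSupBeta_eq [Nontrivial H] [TopologicalSpace G] [CompactSpace G] [MeasurableSpace G]
    [BorelSpace G] [ContinuousMul G] [MeasurableMul G]
    (hU : ∀ v : H, Continuous fun g => (U g : H →L[ℂ] H) v) (ν : Measure G)
    [IsProbabilityMeasure ν] [ν.IsMulRightInvariant] [ν.IsOpenPosMeasure] {α : ℝ≥0∞}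
    (hα : α ≤ 1) : infSupBeta U K α = α / ⨆ m, branchingSum (toRep U) K m := by
  refine le_antisymm ?_ (le_iInf₂ fun ρ hρ => ?_)
  · obtain ⟨m₀, hm₀⟩ := exists_branchingSum_max U K
    obtain ⟨ρ, hρ, h⟩ := exists_state_beta_le hU ν m₀
    refine iInf₂_le_of_le ρ hρ (iSup₂_le fun σ hσ => (h σ hσ α hα).trans ?_)
    exact ENNReal.div_le_div_left (iSup_le hm₀) _
  · obtain ⟨σ, hσ, h⟩ := exists_state_le_beta hρ
    exact le_iSup₂_of_le σ hσ (h α)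

end Evaluation

/-! ### Measurability and Fubini for region estimators -/

section POVMMeasure

variable {X Y H : Type*} [MeasurableSpace X] [MeasurableSpace Y]
  [NormedAddCommGroup H] [InnerProductSpace ℂ H]

/-- The measure of outcomes obtained from a POVM and a positive functional. -/
def POVM.outcomeMeasure (M : POVM Y H) (L : (H →L[ℂ] H) →L[ℝ] ℝ)
    (hL : ∀ E, 0 ≤ E → 0 ≤ L E) : Measure Y :=
  SignedMeasure.toMeasureOfZeroLE
    (M.toVectorMeasure.mapRange (L : (H →L[ℂ] H) →+ ℝ) L.continuous) Set.univ .univ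
    (by
      rw [VectorMeasure.restrict_univ, VectorMeasure.restrict_univ, VectorMeasure.le_iff]
      exact fun O hO => hL _ (M.nonneg O hO))

theorem POVM.outcomeMeasure_apply (M : POVM Y H) (L : (H →L[ℂ] H) →L[ℝ] ℝ)
    (hL : ∀ E, 0 ≤ E → 0 ≤ L E) {O : Set Y} (hO : MeasurableSet O) :
    M.outcomeMeasure L hL O = ENNReal.ofReal (L (M.measureOf' O)) := by
  rw [POVM.outcomeMeasure, SignedMeasure.toMeasureOfZeroLE_apply _ _ .univ hO,
    ← ENNReal.ofReal_eq_coe_nnreal]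
  simp only [Set.univ_inter]
  rfl

theorem POVM.isFiniteMeasure_outcomeMeasure (M : POVM Y H) (L : (H →L[ℂ] H) →L[ℝ] ℝ)
    (hL : ∀ E, 0 ≤ E → 0 ≤ L E) : IsFiniteMeasure (M.outcomeMeasure L hL) :=
  ⟨by rw [M.outcomeMeasure_apply L hL .univ]; exact ENNReal.ofReal_lt_top⟩

theorem POVM.le_one (M : POVM Y H) {O : Set Y} (hO : MeasurableSet O) : M.measureOf' O ≤ 1 := by
  have h1 := M.toVectorMeasure.of_add_of_sdiff hO .univ (Set.subset_univ O)
  have h2 : M.measureOf' O + M.measureOf' (Set.univ \ O) = 1 := h1.trans M.univ_eq_one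
  have h3 := M.nonneg _ (MeasurableSet.univ.diff hO)
  rwa [eq_sub_of_add_eq' h2, ContinuousLinearMap.nonneg_iff_isPositive,
    ← ContinuousLinearMap.le_def] at h3

variable (est : RegionEstimator X Y H)

theorem RegionEstimator.measurableSet_compatible (x : X) : MeasurableSet (est.compatible x) :=
  measurable_prodMk_left est.measurableSet_table

/-- The effect detecting success for the parameter `x`. -/
def RegionEstimator.effect (x : X) : H →L[ℂ] H := est.povm.measureOf' (est.compatible x)

theorem RegionEstimator.effect_nonneg (x : X) : 0 ≤ est.effect x :=
  est.povm.nonneg _ (est.measurableSet_compatible x)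

theorem RegionEstimator.effect_le_one (x : X) : est.effect x ≤ 1 :=
  est.povm.le_one (est.measurableSet_compatible x)

/-- A positive functional turns the POVM into a finite measure, and the sections of a measurable
table have measurable measure. -/
theorem RegionEstimator.measurable_effect (L : (H →L[ℂ] H) →L[ℝ] ℝ)
    (hL : ∀ E, 0 ≤ E → 0 ≤ L E) : Measurable fun x => L (est.effect x) := by
  have := est.povm.isFiniteMeasure_outcomeMeasure L hL
  have h := (measurable_measure_prodMk_left (ν := est.povm.outcomeMeasure L hL)
    est.measurableSet_table).ennreal_toReal
  convert h using 2 with x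
  have := est.povm.outcomeMeasure_apply L hL (est.measurableSet_compatible x)
  change _ = (est.povm.outcomeMeasure L hL (est.compatible x)).toReal
  rw [this]
  exact (ENNReal.toReal_ofReal (hL _ (est.effect_nonneg x))).symm

/-- Fubini's theorem: the average of a positive functional over the effects is bounded by
the maximal volume. -/
theorem RegionEstimator.lintegral_effect_le (vol : Measure X) [SFinite vol]
    (L : (H →L[ℂ] H) →L[ℝ] ℝ) (hL : ∀ E, 0 ≤ E → 0 ≤ L E) :
    ∫⁻ x, ENNReal.ofReal (L (est.effect x)) ∂vol ≤
      est.maxVolume vol * ENNReal.ofReal (L 1) := by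
  have := est.povm.isFiniteMeasure_outcomeMeasure L hL
  have h1 : ∫⁻ x, ENNReal.ofReal (L (est.effect x)) ∂vol =
      (vol.prod (est.povm.outcomeMeasure L hL)) est.table := by
    rw [Measure.prod_apply est.measurableSet_table]
    exact lintegral_congr fun x =>
      (est.povm.outcomeMeasure_apply L hL (est.measurableSet_compatible x)).symm
  rw [h1, Measure.prod_apply_symm est.measurableSet_table]
  refine (lintegral_mono (g := fun _ => est.maxVolume vol) fun y =>
    le_iSup (fun y => vol (est.region y)) y).trans_eq ?_
  rw [lintegral_const, est.povm.outcomeMeasure_apply L hL .univ, est.povm.univ_eq_one]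

variable [FiniteDimensional ℂ H]

/-- Quadratic forms are positive functionals, hence measurable along the effects; polarization gives
the matrix entries, and the operator is a finite combination of rank-one operators with these
coefficients. -/
theorem RegionEstimator.stronglyMeasurable_effect : StronglyMeasurable est.effect := by
  let b := stdOrthonormalBasis ℂ H
  let q (v : H) : (H →L[ℂ] H) →L[ℝ] ℝ := Complex.reCLM ∘L ((innerSL ℂ v ∘L
    ContinuousLinearMap.apply ℂ H v).restrictScalars ℝ)
  have hq (v : H) (A : H →L[ℂ] H) : q v A = (inner ℂ v (A v)).re := rfl
  have hpos {A : H →L[ℂ] H} (hA : 0 ≤ A) : A.IsPositive :=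
    (ContinuousLinearMap.nonneg_iff_isPositive A).1 hA
  have h1 (v : H) : Measurable fun x => inner ℂ (est.effect x v) v := by
    have := (est.measurable_effect (q v) fun E hE => (hpos hE).re_inner_nonneg_right v)
    convert Complex.measurable_ofReal.comp this using 2 with x
    have h0 := (hpos (est.effect_nonneg x)).inner_nonneg_right v
    rw [(hpos (est.effect_nonneg x)).inner_left_eq_inner_right]
    exact Complex.ext rfl (Complex.le_def.1 h0).2.symm
  have h2 (v w : H) : Measurable fun x => inner ℂ (est.effect x v) w := by
    have h3 (x : X) := inner_map_polarization (est.effect x : H →ₗ[ℂ] H) w v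
    simp only [ContinuousLinearMap.coe_coe] at h3
    simp only [h3]
    exact ((((h1 _).sub (h1 _)).add ((h1 _).const_mul _)).sub ((h1 _).const_mul _)).div_const _
  have h4 (A : H →L[ℂ] H) (hA : A.IsPositive) :
      A = ∑ j, ∑ i, inner ℂ (A (b i)) (b j) • InnerProductSpace.rankOne ℂ (b i) (b j) := by
    ext v
    conv_lhs => rw [← b.sum_repr' v, map_sum]
    rw [sum_apply]
    refine Finset.sum_congr rfl fun j _ => ?_
    rw [map_smul, sum_apply]
    conv_lhs => rw [← b.sum_repr' (A (b j)), Finset.smul_sum]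
    refine Finset.sum_congr rfl fun i _ => ?_
    rw [hA.inner_left_eq_inner_right]
    simp [smul_smul, mul_comm]
  rw [show est.effect = fun x => ∑ j, ∑ i, inner ℂ (est.effect x (b i)) (b j) •
    InnerProductSpace.rankOne ℂ (b i) (b j) from
      funext fun x => h4 _ (hpos (est.effect_nonneg x))]
  exact Finset.stronglyMeasurable_fun_sum _ fun j _ =>
    Finset.stronglyMeasurable_fun_sum _ fun i _ =>
    (h2 _ _).stronglyMeasurable.smul_const _

end POVMMeasure

/-! ### Homogeneous spaces and covariant families -/

section Homogeneous

variable {G X : Type*} [Group G] [TopologicalSpace G] [ContinuousMul G] [MeasurableSpace G]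
  [BorelSpace G] [SecondCountableTopology G]
  [TopologicalSpace X] [MeasurableSpace X] [BorelSpace X] [MulAction G X] [ContinuousSMul G X]
  (vol : Measure X) (ν : Measure G)

/-- The normalised invariant measure on a homogeneous space is the image of the Haar measure. -/
theorem map_smul_eq [IsFiniteMeasure vol] [NeZero vol] [SMulInvariantMeasure G X vol]
    [IsProbabilityMeasure ν] [ν.IsMulRightInvariant] [MulAction.IsPretransitive G X] (x₀ : X) :
    ν.map (fun g => g • x₀) = (vol Set.univ)⁻¹ • vol := by
  have hm : Measurable fun p : G × X => p.1 • p.2 := continuous_smul.measurable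
  have hmx (x : X) : Measurable fun g : G => g • x :=
    (continuous_id.smul continuous_const).measurable
  have hmg (g : G) : Measurable fun x : X => g • x := (continuous_const_smul g).measurable
  have h0 : vol Set.univ ≠ 0 := Measure.measure_univ_ne_zero.2 (NeZero.ne vol)
  ext s hs
  have hf : Measurable (s.indicator (1 : X → ℝ≥0∞)) := measurable_one.indicator hs
  -- The indicator of `g • x ∈ s` is integrated over `G × X` in both orders. By transitivity and
  -- right invariance the integral over `G` does not depend on `x`; by invariance of `vol` the
  -- integral over `X` is `vol s`.
  have h1 (x : X) : ∫⁻ g, s.indicator (1 : X → ℝ≥0∞) (g • x) ∂ν = ν.map (fun g => g • x₀) s := by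
    obtain ⟨h, rfl⟩ := MulAction.exists_smul_eq G x₀ x
    simp only [smul_smul]
    rw [lintegral_mul_right_eq_self (fun g => s.indicator (1 : X → ℝ≥0∞) (g • x₀)) h,
      ← lintegral_map hf (hmx x₀), lintegral_indicator_one hs]
  have h2 (g : G) : ∫⁻ x, s.indicator (1 : X → ℝ≥0∞) (g • x) ∂vol = vol s := by
    rw [← lintegral_map hf (hmg g), (measurePreserving_smul g vol).map_eq,
      lintegral_indicator_one hs]
  have h3 := lintegral_lintegral_swap (μ := vol) (ν := ν)
    (f := fun x g => s.indicator (1 : X → ℝ≥0∞) (g • x))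
    (hf.comp (hm.comp measurable_swap)).aemeasurable
  simp only [h1, h2, lintegral_const, measure_univ, mul_one] at h3
  rw [Measure.smul_apply, smul_eq_mul, ← h3, mul_comm (ν.map _ s), ← mul_assoc,
    ENNReal.inv_mul_cancel h0 (measure_ne_top _ _), one_mul]

variable {Y H : Type*} [MeasurableSpace Y] [NormedAddCommGroup H] [InnerProductSpace ℂ H]
  [CompleteSpace H] [FiniteDimensional ℂ H] {U : G →* unitary (H →L[ℂ] H)}

omit [TopologicalSpace X] [BorelSpace X] in
theorem aemeasurable_expVal_effect {ρ : X → H →L[ℂ] H} (hρ : AEStronglyMeasurable ρ vol)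
    (est : RegionEstimator X Y H) : AEMeasurable (fun x => expVal (ρ x) (est.effect x)) vol := by
  have h := (expValL (1 : H →L[ℂ] H)).continuous.comp_aestronglyMeasurable
    (hρ.mul est.stronglyMeasurable_effect.aestronglyMeasurable)
  convert h.aemeasurable using 2 with x
  rw [expValL_apply, expVal_one_left]
  rfl

omit [TopologicalSpace X] [BorelSpace X] [FiniteDimensional ℂ H] in
theorem successProb_le_one [IsFiniteMeasure vol] {ρ : X → H →L[ℂ] H} (hρ : ∀ x, IsState (ρ x))
    (est : RegionEstimator X Y H) : est.successProb vol (uniformPrior vol) ρ ≤ 1 := by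
  refine (lintegral_mono (g := fun _ => (vol Set.univ)⁻¹) fun x => ?_).trans ?_
  · refine mul_le_of_le_one_right' (ENNReal.ofReal_le_one.2 ?_)
    exact (hρ x).expVal_le_one (est.effect_le_one x)
  · rw [lintegral_const]
    exact ENNReal.inv_mul_le_one _

variable {vol}

theorem successProb_eq_lintegral [IsFiniteMeasure vol] [NeZero vol] [SMulInvariantMeasure G X vol]
    [IsProbabilityMeasure ν] [ν.IsMulRightInvariant] [MulAction.IsPretransitive G X] (x₀ : X)
    {ρ : X → H →L[ℂ] H} (hρ : AEStronglyMeasurable ρ vol) (est : RegionEstimator X Y H) :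
    est.successProb vol (uniformPrior vol) ρ =
      ∫⁻ g, ENNReal.ofReal (expVal (ρ (g • x₀)) (est.effect (g • x₀))) ∂ν := by
  have hmx : Measurable fun g : G => g • x₀ := (continuous_id.smul continuous_const).measurable
  have hf : AEMeasurable (fun x => ENNReal.ofReal (expVal (ρ x) (est.effect x)))
      (ν.map fun g => g • x₀) := by
    rw [map_smul_eq vol ν x₀]
    exact (aemeasurable_expVal_effect vol hρ est).ennreal_ofReal.smul_measure _
  rw [← lintegral_map' hf hmx.aemeasurable, map_smul_eq vol ν x₀, lintegral_smul_measure,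
    smul_eq_mul, ← lintegral_const_mul']
  · rfl
  · exact ENNReal.inv_ne_top.2 (Measure.measure_univ_ne_zero.2 (NeZero.ne vol))

/-- Covariance makes `ρ x₀` invariant under the stabilizer. The averaged effect `E` is feasible with
value exactly the success probability, and its value in an invariant `σ` is an average over `X` that
Fubini bounds by the relative maximal volume. -/
theorem infSupBeta_successProb_le [IsFiniteMeasure vol] [NeZero vol] [SMulInvariantMeasure G X vol]
    (ν : Measure G) [IsProbabilityMeasure ν] [ν.IsMulRightInvariant]
    [MulAction.IsPretransitive G X]
    (hU : ∀ v : H, Continuous fun g => (U g : H →L[ℂ] H) v) (x₀ : X)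
    {ρ : X → H →L[ℂ] H} (hρ : IsCovariantFamily vol U ρ) (est : RegionEstimator X Y H) :
    infSupBeta U (MulAction.stabilizer G x₀) (est.successProb vol (uniformPrior vol) ρ) ≤
      est.maxVolume vol / vol Set.univ := by
  have hmx : Measurable fun g : G => g • x₀ := (continuous_id.smul continuous_const).measurable
  have hF : Integrable (fun g => (U g⁻¹ : H →L[ℂ] H) * est.effect (g • x₀) * (U g : H →L[ℂ] H)) ν :=
    integrable_conj hU (est.stronglyMeasurable_effect.comp_measurable hmx).aestronglyMeasurable
      (fun g => est.effect_nonneg _) (fun g => est.effect_le_one _)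
  let E := twirl U ν fun g => est.effect (g • x₀)
  have hE {A : H →L[ℂ] H} (hA : ∀ g, 0 ≤ conjOp U g A) : ENNReal.ofReal (expVal A E) =
      ∫⁻ g, ENNReal.ofReal (expVal (conjOp U g A) (est.effect (g • x₀))) ∂ν := by
    rw [expVal_twirl hF]
    refine ofReal_integral_eq_lintegral_ofReal ?_
      (.of_forall fun g => expVal_nonneg (hA g) (est.effect_nonneg _))
    have := (expValL A).integrable_comp hF
    simpa only [expValL_apply, expVal_conj] using this
  refine iInf₂_le_of_le (ρ x₀) ⟨hρ.isState x₀, fun g hg => ?_⟩ (iSup₂_le fun σ hσ => ?_)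
  · rw [← hρ.covariant, MulAction.mem_stabilizer_iff.1 hg]
  refine iInf_le_of_le E <| iInf_le_of_le (twirl_nonneg fun g => est.effect_nonneg _) <|
    iInf_le_of_le (twirl_le_one hF fun g => est.effect_le_one _) <| iInf_le_of_le ?_ ?_
  · rw [hE fun g => by rw [← hρ.covariant]; exact (hρ.isState _).nonneg,
      successProb_eq_lintegral ν x₀ hρ.measurable]
    simp only [hρ.covariant, le_refl]
  · have hσg (g : G) : conjOp U g σ = σ := hσ.2 g trivial
    have hpos : ∀ A : H →L[ℂ] H, 0 ≤ A → 0 ≤ expValL σ A := fun A hA =>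
      expVal_nonneg hσ.1.nonneg hA
    rw [hE fun g => by rw [hσg]; exact hσ.1.nonneg]
    simp only [hσg]
    rw [← lintegral_map (f := fun x => ENNReal.ofReal (expVal σ (est.effect x)))
      (est.measurable_effect (expValL σ) hpos).ennreal_ofReal hmx, map_smul_eq vol ν x₀,
      lintegral_smul_measure, smul_eq_mul, div_eq_mul_inv, mul_comm]
    gcongr
    refine (est.lintegral_effect_le vol (expValL σ) hpos).trans_eq ?_
    rw [expValL_apply, hσ.1.expVal_one, ENNReal.ofReal_one, mul_one]

end Homogeneous

/-! ### Invariant probability measure on the group -/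

section Haar

/-- A compact second countable group carries a bi-invariant Borel probability measure of full
support. -/
theorem exists_biinvariant_probability (G : Type*) [Group G] [TopologicalSpace G]
    [IsTopologicalGroup G] [CompactSpace G] [SecondCountableTopology G] [MeasurableSpace G]
    [BorelSpace G] : ∃ ν : Measure G, IsProbabilityMeasure ν ∧ ν.IsMulRightInvariant ∧
      ν.IsOpenPosMeasure := by
  let ν : Measure G := Measure.haarMeasure ⊤
  have h1 : IsProbabilityMeasure ν :=
    ⟨Measure.haarMeasure_self (K₀ := (⊤ : TopologicalSpace.PositiveCompacts G))⟩
  refine ⟨ν, h1, ⟨fun g => ?_⟩, inferInstance⟩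
  have hm : Measurable fun x : G => x * g := measurable_mul_const g
  have h2 : IsProbabilityMeasure (ν.map fun x => x * g) :=
    Measure.isProbabilityMeasure_map hm.aemeasurable
  -- A right translate of `ν` is again left invariant of total mass one, so uniqueness of Haar
  -- measure gives right invariance.
  have h3 := Measure.haarMeasure_unique (ν.map fun x => x * g) ⊤
  rw [show ((⊤ : TopologicalSpace.PositiveCompacts G) : Set G) = Set.univ from rfl,
    measure_univ, one_smul] at h3
  exact h3

end Haar

end

end RegionEstimation

theorem mainTheorem4
    -- a compact connected Lie group `G`
    {EG : Type*} [NormedAddCommGroup EG] [NormedSpace ℝ EG] [FiniteDimensional ℝ EG]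
    {G : Type*} [TopologicalSpace G] [ChartedSpace EG G] [Group G] [LieGroup 𝓘(ℝ, EG) ∞ G]
    [T2Space G] [CompactSpace G] [ConnectedSpace G]
    -- a smooth manifold `X` with a smooth transitive action of `G`
    {EX : Type*} [NormedAddCommGroup EX] [NormedSpace ℝ EX] [FiniteDimensional ℝ EX]
    {X : Type*} [TopologicalSpace X] [ChartedSpace EX X] [IsManifold 𝓘(ℝ, EX) ∞ X] [T2Space X]
    [MulAction G X] [ContMDiffSMul 𝓘(ℝ, EG) 𝓘(ℝ, EX) ∞ G X] [MulAction.IsPretransitive G X]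
    -- a finite nonzero `G`-invariant Borel measure on `X`
    [MeasurableSpace X] [BorelSpace X] (vol : Measure X) [IsFiniteMeasure vol] [NeZero vol]
    [SMulInvariantMeasure G X vol]
    -- a nonzero finite-dimensional continuous unitary representation of `G`
    {H : Type*} [NormedAddCommGroup H] [InnerProductSpace ℂ H] [CompleteSpace H]
    [FiniteDimensional ℂ H] [Nontrivial H]
    (U : G →* unitary (H →L[ℂ] H)) (hU : ∀ v : H, Continuous fun g => (U g : H →L[ℂ] H) v)
    -- an arbitrary base point, and a measurable space of measurement outcomes
    (x₀ : X) {Y : Type*} [MeasurableSpace Y] :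
    -- the maximum over `μ` is attained
    (∃ m₀, ∀ m, RegionEstimation.branchingSum (RegionEstimation.toRep U)
        (MulAction.stabilizer G x₀) m ≤
      RegionEstimation.branchingSum (RegionEstimation.toRep U) (MulAction.stabilizer G x₀) m₀) ∧
    -- the evaluation of the infimum over states
    (∀ α : ℝ≥0∞, α ≤ 1 →
      RegionEstimation.infSupBeta U (MulAction.stabilizer G x₀) α =
        α / ⨆ m, RegionEstimation.branchingSum (RegionEstimation.toRep U)
          (MulAction.stabilizer G x₀) m) ∧
    -- the lower bound for region estimators
    (∀ (ρ : X → H →L[ℂ] H) (est : RegionEstimation.RegionEstimator X Y H),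
      RegionEstimation.IsCovariantFamily vol U ρ →
      est.successProb vol (RegionEstimation.uniformPrior vol) ρ ≤ 1 ∧
      RegionEstimation.infSupBeta U (MulAction.stabilizer G x₀)
          (est.successProb vol (RegionEstimation.uniformPrior vol) ρ) ≤
        est.maxVolume vol / vol Set.univ ∧
      RegionEstimation.infSupBeta U (MulAction.stabilizer G x₀)
          (est.successProb vol (RegionEstimation.uniformPrior vol) ρ) =
        est.successProb vol (RegionEstimation.uniformPrior vol) ρ /
          ⨆ m, RegionEstimation.branchingSum (RegionEstimation.toRep U)
            (MulAction.stabilizer G x₀) m) ∧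
    -- the case in which `X` is the group `G` itself, that is, the stabilizer is trivial
    (MulAction.stabilizer G x₀ = ⊥ →
      (∀ α : ℝ≥0∞, α ≤ 1 →
        RegionEstimation.infSupBeta U (MulAction.stabilizer G x₀) α =
          α / RegionEstimation.groupSum (RegionEstimation.toRep U)) ∧
      ∀ (ρ : X → H →L[ℂ] H) (est : RegionEstimation.RegionEstimator X Y H),
        RegionEstimation.IsCovariantFamily vol U ρ →
        est.successProb vol (RegionEstimation.uniformPrior vol) ρ /
            RegionEstimation.groupSum (RegionEstimation.toRep U) ≤
          est.maxVolume vol / vol Set.univ) := by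
  have : SecondCountableTopology EG := secondCountable_of_proper
  have : SecondCountableTopology G := ChartedSpace.secondCountable_of_sigmaCompact EG G
  have : IsTopologicalGroup G := topologicalGroup_of_lieGroup 𝓘(ℝ, EG) ∞
  have : ContinuousSMul G X :=
    ContMDiffSMul.continuousSMul (I := 𝓘(ℝ, EG)) (I' := 𝓘(ℝ, EX)) (n := ∞)
  -- The statement involves no measure on `G`; the Borel structure serves only the averaging.
  let : MeasurableSpace G := borel G
  have : BorelSpace G := ⟨rfl⟩
  obtain ⟨ν, h1, h2, h3⟩ := RegionEstimation.exists_biinvariant_probability G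
  have hmax := RegionEstimation.exists_branchingSum_max U (MulAction.stabilizer G x₀)
  have heval {α : ℝ≥0∞} (hα : α ≤ 1) :=
    RegionEstimation.infSupBeta_eq (K := MulAction.stabilizer G x₀) hU ν hα
  have hle (ρ : X → H →L[ℂ] H) (est : RegionEstimation.RegionEstimator X Y H)
      (hρ : RegionEstimation.IsCovariantFamily vol U ρ) :=
    RegionEstimation.successProb_le_one vol hρ.isState est
  have hbound (ρ : X → H →L[ℂ] H) (est : RegionEstimation.RegionEstimator X Y H)
      (hρ : RegionEstimation.IsCovariantFamily vol U ρ) :=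
    RegionEstimation.infSupBeta_successProb_le ν hU x₀ hρ est
  refine ⟨hmax, fun α hα => heval hα, fun ρ est hρ =>
    ⟨hle ρ est hρ, hbound ρ est hρ, heval (hle ρ est hρ)⟩, fun hK => ?_⟩
  have hsup : ⨆ m, RegionEstimation.branchingSum (RegionEstimation.toRep U)
      (MulAction.stabilizer G x₀) m = RegionEstimation.groupSum (RegionEstimation.toRep U) := by
    -- An isotype must exist, since a supremum over an empty index would be `0`.
    obtain ⟨m₀, -⟩ := hmax
    have : Nonempty (RegionEstimation.Isotype (RegionEstimation.restrictRep
      (RegionEstimation.toRep U) (MulAction.stabilizer G x₀))) := ⟨m₀⟩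
    simp only [RegionEstimation.branchingSum_of_eq_bot hK, ciSup_const]
  refine ⟨fun α hα => by rw [heval hα, hsup], fun ρ est hρ => ?_⟩
  rw [← hsup, ← heval (hle ρ est hρ)]
  exact hbound ρ est hρ
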